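/- All matroids are finite. For a matroid $M$ with ground set $E(M)$ and rank function $r$, and for $X\subseteq E(M)$, let $\lambda_M(X)=r(X)+r(E(M)\setminus X)-r(M)$. A $k$-separation of $M$ is a partition $(X,Y)$ of $E(M)$ with $|X|,|Y|\ge k$ and $\lambda_M(X)<k$, and $M$ is 3-connected if it has no $k$-separation with $k<3$. A triangle is a 3-element circuit, and a triad is a 3-element cocircuit. A fan of $M$ is a sequence $(x_1,\dots,x_k)$, $k\ge 3$, of distinct elements of $E(M)$ such that $\{x_1,x_2,x_3\}$ is a triangle or a triad and, for each $i\in\{1,\dots,k-3\}$, if $\{x_i,x_{i+1},x_{i+2}\}$ is a triangle then $\{x_{i+1},x_{i+2},x_{i+3}\}$ is a triad, and if $\{x_i,x_{i+1},x_{i+2}\}$ is a triad then $\{x_{i+1},x_{i+2},x_{i+3}\}$ is a triangle. A fan is inclusionwise maximal if its set of elements is not properly contained in the set of elements of another fan of $M$. A wheel is a matroid isomorphic to the cycle matroid of a wheel graph with $r\ge 2$ spokes (for $r=2$ the two rim edges are parallel), and a whirl is a matroid isomorphic to one obtained from such a cycle matroid by relaxing the rim, that is, by declaring the rim to be a basis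 (so $U_{2,4}$ is a whirl). Let $M$ be a 3-connected matroid that is not a wheel or a whirl, let $N$ be a minor of $M$ without loops or coloops, and let $F=(x_1,x_2,\dots,x_k)$ be an inclusionwise maximal fan of $M$ with $k\ge 4$ elements. If $|E(N)\cap\{x_1,\dots,x_k\}|\le 1$, then at least one of the matroids $M\backslash x_1$, $M/x_1$, $M\backslash x_k$, $M/x_k$ is 3-connected and has $N$ as a minor. -/

import Mathlib

open Set

namespace Matroid

variable {α : Type*}

/-- The connectivity function `λ_M(X) = r(X) + r(E - X) - r(M)`. For a finite matroid all three
ranks are finite, and submodularity of the rank shows that the subtraction is not truncated. -/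
noncomputable def conn (M : Matroid α) (X : Set α) : ℕ∞ :=
  M.eRk X + M.eRk (M.E \ X) - M.eRank

/-- `(X, Y)` is a `k`-separation of `M`. -/
def IsSeparation (M : Matroid α) (k : ℕ) (X Y : Set α) : Prop :=
  X ∪ Y = M.E ∧ Disjoint X Y ∧ (k : ℕ∞) ≤ X.encard ∧ (k : ℕ∞) ≤ Y.encard ∧ M.conn X < k

/-- `M` is `k`-connected: it has no `k'`-separation with `k' < k`. -/
def IsKConnected (M : Matroid α) (k : ℕ) : Prop :=
  ∀ k' < k, ∀ X Y : Set α, ¬ M.IsSeparation k' X Y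

/-- A triangle is a three-element circuit. -/
def IsTriangle (M : Matroid α) (T : Set α) : Prop :=
  M.IsCircuit T ∧ T.encard = 3

/-- A triad is a triangle of the dual. -/
def IsTriad (M : Matroid α) (T : Set α) : Prop :=
  M✶.IsTriangle T

/-- The set of the three consecutive entries of `x` that start at position `i` (counted from `0`). -/
def consecutiveTriple {k : ℕ} (x : Fin k → α) (i : ℕ) (h : i + 2 < k) : Set α :=
  {x ⟨i, by omega⟩, x ⟨i + 1, by omega⟩, x ⟨i + 2, h⟩}

/-- The sequence `x` of `k ≥ 3` distinct elements is a fan of `M`: the first three elements form a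
triangle or a triad, and from then on the consecutive triples alternate between triangles and
triads. -/
structure IsFan (M : Matroid α) {k : ℕ} (x : Fin k → α) : Prop where
  three_le : 3 ≤ k
  injective : Function.Injective x
  mem_ground : ∀ i, x i ∈ M.E
  first : M.IsTriangle (consecutiveTriple x 0 three_le) ∨
    M.IsTriad (consecutiveTriple x 0 three_le)
  triad_of_triangle : ∀ (i : ℕ) (h : i + 3 < k),
    M.IsTriangle (consecutiveTriple x i (by omega)) → M.IsTriad (consecutiveTriple x (i + 1) h)
  triangle_of_triad : ∀ (i : ℕ) (h : i + 3 < k),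
    M.IsTriad (consecutiveTriple x i (by omega)) → M.IsTriangle (consecutiveTriple x (i + 1) h)

/-- A fan is (inclusionwise) maximal if its set of elements is not properly contained in the set of
elements of another fan. -/
def IsMaximalFan (M : Matroid α) {k : ℕ} (x : Fin k → α) : Prop :=
  M.IsFan x ∧ ∀ (m : ℕ) (y : Fin m → α), M.IsFan y → range x ⊆ range y → range y = range x

/-- In the multigraph with vertex set `V`, edge set `ε` and end map `ends`, the set `C` is the edge
set of a cycle: it can be listed as `e₀, …, eₙ₋₁` (`n ≥ 1`, distinct edges) along distinct vertices
`v₀, …, vₙ₋₁` so that `eᵢ` joins `vᵢ` and `vᵢ₊₁`, indices modulo `n`. -/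
def IsCycleEdgeSet {V ε : Type*} (ends : ε → Sym2 V) (C : Set ε) : Prop :=
  ∃ n : ℕ, 0 < n ∧ ∃ (v : ZMod n → V) (e : ZMod n → ε),
    Function.Injective v ∧ Function.Injective e ∧ range e = C ∧
      ∀ i, ends (e i) = s(v i, v (i + 1))

/-- A set of edges of a multigraph is a forest, that is, independent in the cycle matroid, if it
contains the edge set of no cycle. -/
def IsForest {V ε : Type*} (ends : ε → Sym2 V) (X : Set ε) : Prop :=
  ∀ C ⊆ X, ¬ IsCycleEdgeSet ends C

/-- The ends of the edges of the wheel graph with `r` spokes. The vertices are the hub `none` and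
the rim vertices `some i`; the edge `Sum.inl i` is the spoke from the hub to `some i`, and the edge
`Sum.inr i` is the rim edge from `some i` to `some (i + 1)`, indices modulo `r`. For `r = 2` the two
rim edges are parallel. -/
def wheelEnds (r : ℕ) : ZMod r ⊕ ZMod r → Sym2 (Option (ZMod r))
  | Sum.inl i => s(none, some i)
  | Sum.inr i => s(some i, some (i + 1))

/-- `M` is a wheel: it is isomorphic to the cycle matroid of a wheel graph. -/
def IsWheel (M : Matroid α) : Prop :=
  ∃ r : ℕ, 2 ≤ r ∧ ∃ φ : ZMod r ⊕ ZMod r → α, Function.Injective φ ∧ range φ = M.E ∧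
    ∀ X, M.Indep (φ '' X) ↔ IsForest (wheelEnds r) X

/-- `M` is a whirl: it is isomorphic to the matroid obtained from the cycle matroid of a wheel graph
by relaxing the rim, that is, by making the rim a basis. -/
def IsWhirl (M : Matroid α) : Prop :=
  ∃ r : ℕ, 2 ≤ r ∧ ∃ φ : ZMod r ⊕ ZMod r → α, Function.Injective φ ∧ range φ = M.E ∧
    ∀ X, M.Indep (φ '' X) ↔ (IsForest (wheelEnds r) X ∨ X = range Sum.inr)

end Matroid


/-!
Reversing the fan and passing to the dual matroid, it suffices to treat a maximal fan
`x₀, x₁, …` that begins with a triangle, and to compare `M ＼ {x₀}` with the removal of the last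
element. If `M ＼ {x₀}` is not 3-connected, then, as in Tutte's triangle lemma, `x₀` and one of
`x₁`, `x₂` lie in a further triad. By orthogonality with the triangles of the fan, the third
element `z` of that triad either extends the fan, against maximality, or is its last element. In
the latter case the fan closes up cyclically, its elements span both `M` and `M✶`, hence they are
all of `E(M)`, and `M` is a wheel or a whirl.

For the minor: since `N` has neither loops nor coloops, contracting an element of a triangle that
avoids `N` forces the deletion of a second one, and dually for triads. Hence, if `N` avoids
`{x₀, x₁, x₂}`, an occurrence of `N` in `M ／ {x₀}` can be moved to `M ＼ {x₀}`. As `N` meets the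
fan in at most one element, this applies at one of the two ends, except for a few short fans in
which `N` uses a middle element.
-/

namespace MatroidFan

open Matroid

variable {α : Type*} {M N : Matroid α} {a b c d e : α} {X Y : Set α} {k : ℕ}

/-! ### Rank and connectivity -/

section Rank

/-- The rank of a set as a natural number. It is `0` on sets of infinite rank, hence it is only
used for matroids of finite rank. -/
noncomputable def rk (M : Matroid α) (X : Set α) : ℕ := (M.eRk X).toNat

section RankFinite

variable [M.RankFinite]

lemma cast_rk (M : Matroid α) [M.RankFinite] (X : Set α) : (rk M X : ℕ∞) = M.eRk X :=
  ENat.natCast_toNat (M.isRkFinite_set X).eRk_lt_top.ne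

lemma rk_mono (h : X ⊆ Y) : rk M X ≤ rk M Y := by
  have := M.eRk_mono h
  rw [← cast_rk, ← cast_rk] at this
  exact_mod_cast this

lemma rk_insert_le (e : α) (X : Set α) : rk M (insert e X) ≤ rk M X + 1 := by
  have := M.eRk_insert_le_add_one e X
  rw [← cast_rk, ← cast_rk] at this
  exact_mod_cast this

lemma rk_union_le (X Y : Set α) : rk M (X ∪ Y) ≤ rk M X + rk M Y := by
  have := M.eRk_union_le_eRk_add_eRk X Y
  simp only [← cast_rk] at this
  exact_mod_cast this

lemma rk_ground_le (X : Set α) : rk M M.E ≤ rk M X + rk M (M.E \ X) :=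
  (rk_mono (by rw [union_sdiff_self]; exact subset_union_right)).trans (rk_union_le X (M.E \ X))

lemma rk_le_ncard (hX : X.Finite) : rk M X ≤ X.ncard := by
  have := M.eRk_le_encard X
  rw [← cast_rk, ← hX.cast_ncard_eq] at this
  exact_mod_cast this

lemma rk_le_of_subset_closure (h : X ⊆ M.closure Y) : rk M X ≤ rk M Y := by
  have := M.eRk_mono h
  rw [eRk_closure_eq, ← cast_rk, ← cast_rk] at this
  exact_mod_cast this

lemma rk_insert_of_notMem_closure (he : e ∈ M.E) (h : e ∉ M.closure X) :
    rk M (insert e X) = rk M X + 1 := by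
  have := eRk_insert_eq_add_one ⟨he, h⟩
  simp only [← cast_rk] at this
  exact_mod_cast this

lemma indep_iff_rk_eq_ncard (hX : X.Finite) : M.Indep X ↔ rk M X = X.ncard := by
  rw [indep_iff_eRk_eq_encard_of_finite hX, ← cast_rk, ← hX.cast_ncard_eq, Nat.cast_inj]

end RankFinite

lemma rk_insert_of_mem_closure (h : e ∈ M.closure X) : rk M (insert e X) = rk M X := by
  rw [rk, rk, ← eRk_closure_eq, closure_insert_eq_of_mem_closure h, eRk_closure_eq]

lemma rk_delete_of_subset {D : Set α} (h : X ⊆ M.E \ D) : rk (M ＼ D) X = rk M X := by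
  rw [rk, rk, delete_eq_restrict, restrict_eRk_eq _ h]

variable [M.Finite]

lemma rk_dual_add_rk_ground (hX : X ⊆ M.E) :
    rk M✶ X + rk M M.E = rk M (M.E \ X) + X.ncard := by
  have := M.eRk_dual_add_eRank X hX
  rw [← eRk_ground, ← cast_rk, ← cast_rk, ← cast_rk,
    ← (M.ground_finite.subset hX).cast_ncard_eq] at this
  exact_mod_cast this

lemma rk_ground_add_rk_dual_ground : rk M M.E + rk M✶ M.E = M.E.ncard := by
  have h := rk_dual_add_rk_ground (M := M) subset_rfl
  have h0 : rk M (M.E \ M.E) = 0 := by simp [rk]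
  omega

end Rank

section Connectivity

variable [M.Finite]

lemma conn_eq_cast (M : Matroid α) [M.Finite] (X : Set α) :
    M.conn X = ((rk M X + rk M (M.E \ X) - rk M M.E : ℕ) : ℕ∞) := by
  rw [conn, ← eRk_ground, ← cast_rk, ← cast_rk, ← cast_rk]
  norm_cast

lemma conn_dual (hX : X ⊆ M.E) : M✶.conn X = M.conn X := by
  rw [conn_eq_cast, conn_eq_cast, dual_ground]
  have hdualX := rk_dual_add_rk_ground hX
  have hdualY := rk_dual_add_rk_ground (M := M) (X := M.E \ X) sdiff_subset
  rw [sdiff_sdiff_cancel_left hX] at hdualY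
  have hsum := rk_ground_add_rk_dual_ground (M := M)
  have hcard := ncard_sdiff_add_ncard_of_subset hX M.ground_finite
  congr 1
  omega

lemma IsKConnected.dual (h : M.IsKConnected k) : M✶.IsKConnected k := by
  rintro j hj X Y ⟨hU, hd, hX, hY, hconn⟩
  rw [dual_ground] at hU
  rw [conn_dual (hU ▸ subset_union_left)] at hconn
  exact h j hj X Y ⟨hU, hd, hX, hY, hconn⟩

lemma isKConnected_dual_iff : M✶.IsKConnected k ↔ M.IsKConnected k :=
  ⟨fun h ↦ by simpa using IsKConnected.dual h, IsKConnected.dual⟩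

lemma isKConnected_iff_rk : M.IsKConnected k ↔ ∀ j < k, ∀ X ⊆ M.E, j ≤ X.ncard →
    j ≤ (M.E \ X).ncard → rk M M.E + j ≤ rk M X + rk M (M.E \ X) := by
  have hcast {X : Set α} {j : ℕ} (hX : X ⊆ M.E) : (j : ℕ∞) ≤ X.encard ↔ j ≤ X.ncard := by
    rw [← (M.ground_finite.subset hX).cast_ncard_eq, Nat.cast_le]
  constructor
  · intro h j hj X hX hjX hjY
    by_contra hlt
    refine h j hj X (M.E \ X) ⟨union_sdiff_cancel hX, disjoint_sdiff_right, (hcast hX).2 hjX,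
      (hcast sdiff_subset).2 hjY, ?_⟩
    rw [conn_eq_cast, Nat.cast_lt]
    have := rk_ground_le (M := M) X
    omega
  · rintro h j hj X Y ⟨hU, hd, hX, hY, hconn⟩
    have hXE : X ⊆ M.E := hU ▸ subset_union_left
    obtain rfl : M.E \ X = Y := by rw [← hU, union_sdiff_left, hd.sdiff_eq_right]
    have := h j hj X hXE ((hcast hXE).1 hX) ((hcast sdiff_subset).1 hY)
    rw [conn_eq_cast, Nat.cast_lt] at hconn
    omega

lemma IsKConnected.indep_of_ncard_lt (hM : M.IsKConnected (k + 1)) (hE : 2 * k ≤ M.E.ncard)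
    (hX : X ⊆ M.E) (hXk : X.ncard < k + 1) : M.Indep X := by
  obtain ⟨Y, hXY, hYE, hY⟩ := exists_subsuperset_card_eq (n := k) hX (by omega) (by omega)
  refine Indep.subset ?_ hXY
  have hYfin := M.ground_finite.subset hYE
  have hcard := ncard_sdiff_add_ncard_of_subset hYE M.ground_finite
  have hsep := isKConnected_iff_rk.1 hM k (by omega) Y hYE hY.ge (by omega)
  have hmono := rk_mono (M := M) (X := M.E \ Y) sdiff_subset
  have hle := rk_le_ncard (M := M) hYfin
  rw [indep_iff_rk_eq_ncard hYfin]
  omega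

lemma IsKConnected.rk_sdiff_eq (hM : M.IsKConnected (k + 1)) (hE : 2 * k ≤ M.E.ncard)
    (hX : X ⊆ M.E) (hXk : X.ncard < k + 1) : rk M (M.E \ X) = rk M M.E := by
  have hindep := IsKConnected.indep_of_ncard_lt (IsKConnected.dual hM) hE hX hXk
  rw [indep_iff_rk_eq_ncard (M.ground_finite.subset hX)] at hindep
  have := rk_dual_add_rk_ground hX
  omega

lemma IsKConnected.le_ncard_of_isCircuit (hM : M.IsKConnected (k + 1)) (hE : 2 * k ≤ M.E.ncard)
    {C : Set α} (hC : M.IsCircuit C) : k + 1 ≤ C.ncard := by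
  by_contra! h
  exact hC.not_indep (IsKConnected.indep_of_ncard_lt hM hE hC.subset_ground h)

lemma IsKConnected.mem_closure_of_ncard_sdiff_lt (hM : M.IsKConnected (k + 1))
    (hE : 2 * k ≤ M.E.ncard) (hX : X ⊆ M.E) (hXk : (M.E \ X).ncard < k + 1) (he : e ∈ M.E) :
    e ∈ M.closure X := by
  by_contra h
  have hrk := IsKConnected.rk_sdiff_eq hM hE sdiff_subset hXk
  rw [sdiff_sdiff_cancel_left hX] at hrk
  have hins := rk_insert_of_notMem_closure he h
  have := rk_mono (M := M) (insert_subset he hX)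
  omega

lemma IsKConnected.ncard_sdiff_lt {j : ℕ} (hM : M.IsKConnected k) (hj : j < k) (hX : X ⊆ M.E)
    (hjX : j ≤ X.ncard) (hlt : rk M X + rk M✶ X < X.ncard + j) : (M.E \ X).ncard < j := by
  by_contra! hcon
  have hsep := isKConnected_iff_rk.1 hM j hj X hX hjX hcon
  have := rk_dual_add_rk_ground hX
  omega

end Connectivity

/-! ### Minors, triangles and triads -/

section Minors

lemma isMinor_dual_iff : N✶ ≤m M✶ ↔ N ≤m M := by
  have hdual {N M : Matroid α} (h : N ≤m M) : N✶ ≤m M✶ := by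
    obtain ⟨C, D, rfl⟩ := h
    exact ⟨D \ C, C, by rw [dual_contract_delete, delete_contract_comm']⟩
  exact ⟨fun h ↦ by simpa only [dual_dual] using hdual h, hdual⟩

lemma delete_isMinor (M : Matroid α) (D : Set α) : M ＼ D ≤m M := ⟨∅, D, by simp⟩

lemma contract_isMinor (M : Matroid α) (C : Set α) : M ／ C ≤m M := ⟨C, ∅, by simp⟩

lemma isMinor_delete_or_contract (h : N ≤m M) (he : e ∉ N.E) :
    N ≤m M ＼ {e} ∨ N ≤m M ／ {e} := by
  obtain ⟨C, D, -, -, -, rfl⟩ := h.exists_eq_contract_delete_disjoint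
  by_cases heM : e ∈ M.E
  · by_cases heC : e ∈ C
    · refine .inr ⟨C, D, ?_⟩
      rw [contract_contract, singleton_union, insert_eq_of_mem heC]
    · have heD : e ∈ D := by
        by_contra heD
        exact he ⟨⟨heM, heC⟩, heD⟩
      refine .inl ⟨C, D, ?_⟩
      rw [← contract_delete_comm _ (by simpa using heC), delete_delete, singleton_union,
        insert_eq_of_mem heD]
  · left
    rwa [deleteElem_eq_self heM]

end Minors

section Triangles

variable {T K : Set α}

lemma IsTriangle.ncard_eq (h : M.IsTriangle T) : T.ncard = 3 := by
  rw [ncard, h.2, ENat.toNat_ofNat]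

lemma IsTriangle.subset_ground (h : M.IsTriangle T) : T ⊆ M.E := h.1.subset_ground

lemma IsTriad.subset_ground (h : M.IsTriad T) : T ⊆ M.E := IsTriangle.subset_ground (M := M✶) h

lemma dual_isTriad : M✶.IsTriad T ↔ M.IsTriangle T := by
  rw [IsTriad, dual_dual]

lemma IsTriangle.ne (h : M.IsTriangle {a, b, c}) : a ≠ b ∧ a ≠ c ∧ b ≠ c := by
  have hpair (u v : α) : ({u, v} : Set α).encard ≠ 3 :=
    ((encard_insert_le {v} u).trans_lt (by rw [encard_singleton]; norm_num)).ne
  have hcard := h.2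
  refine ⟨?_, ?_, ?_⟩ <;> rintro rfl
  · exact hpair a c (by simpa using hcard)
  · exact hpair b a (by simpa [pair_comm] using hcard)
  · exact hpair a b (by simpa using hcard)

lemma IsTriangle.swap (h : M.IsTriangle {a, b, c}) : M.IsTriangle {b, a, c} := by
  rwa [insert_comm]

lemma IsTriangle.swap_right (h : M.IsTriangle {a, b, c}) : M.IsTriangle {a, c, b} := by
  rwa [pair_comm]

lemma IsTriad.ne (h : M.IsTriad {a, b, c}) : a ≠ b ∧ a ≠ c ∧ b ≠ c := IsTriangle.ne h

lemma IsTriad.swap (h : M.IsTriad {a, b, c}) : M.IsTriad {b, a, c} := IsTriangle.swap h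

lemma IsTriad.swap_right (h : M.IsTriad {a, b, c}) : M.IsTriad {a, c, b} :=
  IsTriangle.swap_right h

lemma IsTriangle.mem_closure (h : M.IsTriangle {a, b, c}) : a ∈ M.closure {b, c} := by
  obtain ⟨hab, hac, -⟩ := IsTriangle.ne h
  have := h.1.mem_closure_sdiff_singleton_of_mem (e := a) (by simp)
  rwa [insert_sdiff_self_of_notMem (by simp [hab, hac])] at this

lemma IsTriangle.rk_eq [M.RankFinite] (h : M.IsTriangle T) : rk M T = 2 := by
  have hrk := h.1.eRk_add_one_eq
  rw [h.2, ← cast_rk] at hrk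
  have : rk M T + 1 = 3 := by exact_mod_cast hrk
  omega

lemma IsTriangle.mem_or_mem (hT : M.IsTriangle {a, b, c}) (hK : M.IsCocircuit K) (ha : a ∈ K) :
    b ∈ K ∨ c ∈ K := by
  by_contra! h
  refine hT.1.inter_isCocircuit_ne_singleton hK (e := a) ?_
  ext y
  simp only [mem_inter_iff, mem_insert_iff, mem_singleton_iff]
  grind

lemma IsTriad.mem_or_mem (hT : M.IsTriad {a, b, c}) (hK : M.IsCircuit K) (ha : a ∈ K) :
    b ∈ K ∨ c ∈ K :=
  IsTriangle.mem_or_mem hT (by rwa [dual_isCocircuit_iff]) ha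

lemma IsTriad.contract (h : M.IsTriad T) (he : e ∉ T) : (M ／ {e}).IsTriad T := by
  refine ⟨?_, h.2⟩
  rw [dual_contract, delete_isCircuit_iff]
  exact ⟨h.1, disjoint_singleton_right.2 he⟩

lemma IsTriangle.contract_pair_delete_eq (h : M.IsTriangle {a, b, c}) :
    M ／ {a, b} ＼ {c} = M ／ {a, b, c} := by
  obtain ⟨-, hac, hbc⟩ := IsTriangle.ne h
  have hc : c ∈ (M ／ {a, b}).loops := by
    rw [contract_loops_eq]
    exact ⟨IsTriangle.mem_closure (IsTriangle.swap (IsTriangle.swap_right h)),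
      by simp [hac.symm, hbc.symm]⟩
  rw [← contract_eq_delete_of_subset_loops (singleton_subset_iff.2 hc), contract_contract,
    insert_union, singleton_union]

lemma IsTriangle.contract_delete_eq (h : M.IsTriangle {a, b, c}) :
    M ／ {a, b} ＼ {c} = M ／ {a, c} ＼ {b} := by
  rw [IsTriangle.contract_pair_delete_eq h,
    IsTriangle.contract_pair_delete_eq (IsTriangle.swap_right h), pair_comm c b]

lemma IsTriangle.isMinor_contract_delete (hT : M.IsTriangle {a, b, c}) (hN : N ≤m M ／ {a})
    (hb : b ∉ N.E) (hloop : ∀ e, ¬ N.IsLoop e) : N ≤m M ／ {a} ＼ {b} := by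
  obtain ⟨-, hac, hbc⟩ := IsTriangle.ne hT
  obtain h | h := isMinor_delete_or_contract hN hb
  · exact h
  rw [contract_contract, singleton_union] at h
  have hcloop : (M ／ {a, b}).IsLoop c := by
    rw [contract_isLoop_iff_mem_closure]
    exact ⟨IsTriangle.mem_closure (IsTriangle.swap (IsTriangle.swap_right hT)),
      by simp [hac.symm, hbc.symm]⟩
  have hc : c ∉ N.E := fun hc ↦ hloop c (hcloop.of_isMinor hc h)
  have h' : N ≤m M ／ {a, b} ＼ {c} := by
    obtain h | h := isMinor_delete_or_contract h hc
    · exact h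
    · rwa [contract_eq_delete_of_subset_loops (singleton_subset_iff.2 hcloop)] at h
  rw [IsTriangle.contract_delete_eq hT, ← singleton_union, ← contract_contract,
    contract_delete_comm _ (by simpa using hbc.symm)] at h'
  exact h'.trans (contract_isMinor _ _)

lemma IsTriad.isMinor_delete_contract (hT : M.IsTriad {a, b, c}) (hN : N ≤m M ＼ {a})
    (hb : b ∉ N.E) (hcoloop : ∀ e, ¬ N.IsColoop e) : N ≤m M ＼ {a} ／ {b} := by
  rw [← isMinor_dual_iff, dual_delete_contract]
  refine IsTriangle.isMinor_contract_delete hT ?_ hb (by simpa using hcoloop)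
  rwa [← dual_delete, isMinor_dual_iff]

lemma isMinor_delete_of_isTriangle_of_isTriad (hT : M.IsTriangle {a, b, c})
    (hK : M.IsTriad {b, c, d}) (had : a ≠ d) (hN : N ≤m M) (hloop : ∀ e, ¬ N.IsLoop e)
    (hcoloop : ∀ e, ¬ N.IsColoop e) (ha : a ∉ N.E) (hb : b ∉ N.E) (hc : c ∉ N.E) :
    N ≤m M ＼ {a} := by
  obtain ⟨hab, hac, hbc⟩ := IsTriangle.ne hT
  obtain h | h := isMinor_delete_or_contract hN ha
  · exact h
  have hKa : (M ／ {a}).IsTriad {b, c, d} := IsTriad.contract hK (by simp [hab, hac, had])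
  have hNb := IsTriangle.isMinor_contract_delete hT h hb hloop
  have hNc := IsTriad.isMinor_delete_contract hKa hNb hc hcoloop
  rw [contract_delete_contract _ _ _ _ (by simpa using hbc.symm), singleton_union, pair_comm,
    IsTriangle.contract_delete_eq (IsTriangle.swap (IsTriangle.swap_right hT)),
    contract_delete_comm _ (by simp [hac, hab])] at hNc
  exact hNc.trans (contract_isMinor _ _)

lemma isMinor_delete_or_contract_of_isTriangle_of_isTriad (hT : M.IsTriangle {a, b, c})
    (hK : M.IsTriad {b, c, d}) (had : a ≠ d) (hN : N ≤m M) (hloop : ∀ e, ¬ N.IsLoop e)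
    (hcoloop : ∀ e, ¬ N.IsColoop e) (ha : a ∉ N.E) (hb : b ∉ N.E) (hd : d ∉ N.E) :
    N ≤m M ＼ {a} ∨ N ≤m M ／ {d} := by
  obtain ⟨hab, hac, -⟩ := IsTriangle.ne hT
  obtain h | h := isMinor_delete_or_contract hN ha
  · exact .inl h
  have hKa : (M ／ {a}).IsTriad {b, d, c} :=
    IsTriad.swap_right (IsTriad.contract hK (by simp [hab, hac, had]))
  have hNb := IsTriangle.isMinor_contract_delete hT h hb hloop
  have hNd := IsTriad.isMinor_delete_contract hKa hNb hd hcoloop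
  rw [contract_delete_contract _ _ _ _ (by simpa using (IsTriad.ne hK).2.1.symm), union_comm,
    ← contract_contract] at hNd
  exact .inr ((hNd.trans (delete_isMinor _ _)).trans (contract_isMinor _ _))

end Triangles

section ThreeConnected

variable [M.Finite] {T K : Set α}

lemma IsKConnected.isTriangle_of_isCircuit_subset (hM : M.IsKConnected 3) (hE : 4 ≤ M.E.ncard)
    {C : Set α} (hC : M.IsCircuit C) (hCT : C ⊆ T) (hcard : T.ncard = 3) : M.IsTriangle T := by
  have hfin : T.Finite := finite_of_ncard_ne_zero (by omega)
  have hC3 := IsKConnected.le_ncard_of_isCircuit hM hE hC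
  obtain rfl : C = T := eq_of_subset_of_ncard_le hCT (by omega) hfin
  exact ⟨hC, by rw [← hfin.cast_ncard_eq, hcard, Nat.cast_ofNat]⟩

lemma IsKConnected.isTriangle_of_rk_le (hM : M.IsKConnected 3) (hE : 4 ≤ M.E.ncard)
    (hT : T ⊆ M.E) (hcard : T.ncard = 3) (hrk : rk M T ≤ 2) : M.IsTriangle T := by
  have hdep : ¬ M.Indep T := by
    rw [indep_iff_rk_eq_ncard (M.ground_finite.subset hT)]
    omega
  obtain ⟨C, hCT, hC⟩ := Dep.exists_isCircuit_subset ⟨hdep, hT⟩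
  exact IsKConnected.isTriangle_of_isCircuit_subset hM hE hC hCT hcard

lemma IsKConnected.isTriad_of_rk_lt (hM : M.IsKConnected 3) (hE : 4 ≤ M.E.ncard)
    (hT : T ⊆ M.E) (hcard : T.ncard = 3) (hrk : rk M (M.E \ T) < rk M M.E) : M.IsTriad T := by
  refine IsKConnected.isTriangle_of_rk_le (IsKConnected.dual hM) hE hT hcard ?_
  have := rk_dual_add_rk_ground hT
  omega

lemma IsKConnected.not_isTriangle_and_isTriad (hM : M.IsKConnected 3) (hE : 5 ≤ M.E.ncard) :
    ¬ (M.IsTriangle T ∧ M.IsTriad T) := by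
  rintro ⟨hT, hK⟩
  have hcard := ncard_sdiff_add_ncard_of_subset (IsTriangle.subset_ground hT) M.ground_finite
  have hT3 := IsTriangle.ncard_eq hT
  have hrk := IsTriangle.rk_eq hT
  have hdual := IsTriangle.rk_eq (M := M✶) hK
  have := IsKConnected.ncard_sdiff_lt hM (j := 2) (by omega) (IsTriangle.subset_ground hT)
    (by omega) (by omega)
  omega

lemma IsKConnected.rk_ground_add_three_le (hM : M.IsKConnected 3) (hE : 5 ≤ M.E.ncard)
    (hT : M.IsTriangle T) : rk M M.E + 3 ≤ M.E.ncard := by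
  have hcard := ncard_sdiff_add_ncard_of_subset (IsTriangle.subset_ground hT) M.ground_finite
  have hT3 := IsTriangle.ncard_eq hT
  have hsep := isKConnected_iff_rk.1 hM 2 (by omega) T (IsTriangle.subset_ground hT)
    (by omega) (by omega)
  have hrk := IsTriangle.rk_eq hT
  have hle : rk M (M.E \ T) ≤ _ := rk_le_ncard M.ground_finite.sdiff
  omega

lemma IsKConnected.six_le_ncard (hM : M.IsKConnected 3) (hE : 5 ≤ M.E.ncard)
    (hT : M.IsTriangle T) (hK : M.IsTriad K) : 6 ≤ M.E.ncard := by
  have hrk := IsKConnected.rk_ground_add_three_le hM hE hT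
  have hrkdual := IsKConnected.rk_ground_add_three_le (IsKConnected.dual hM) hE hK
  have hsum := rk_ground_add_rk_dual_ground (M := M)
  simp only [dual_ground] at hrkdual
  omega

end ThreeConnected

/-! ### Cycles of wheel graphs -/

section Wheel

lemma isCycleEdgeSet_inter_ne_singleton {V ε : Type*} {ends : ε → Sym2 V}
    (hends : ∀ f, ¬ (ends f).IsDiag) {C : Set ε} (hC : IsCycleEdgeSet ends C) (w : V) (f : ε) :
    C ∩ {g | w ∈ ends g} ≠ {f} := by
  obtain ⟨n, hn, v, e, hv, he, rfl, hev⟩ := hC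
  intro hf
  obtain ⟨⟨j, rfl⟩, hw⟩ : f ∈ range e ∩ {g | w ∈ ends g} := hf ▸ mem_singleton f
  have huniq {l : ZMod n} (hl : w ∈ ends (e l)) : l = j := he (hf.subset ⟨⟨l, rfl⟩, hl⟩)
  have hn1 : Fact (1 < n) := by
    refine ⟨Nat.lt_of_le_of_ne hn ?_⟩
    rintro rfl
    refine hends (e 0) ?_
    rw [hev, Subsingleton.elim (0 + 1 : ZMod 1) 0, Sym2.mk_isDiag_iff]
  simp only [mem_ofPred_eq, hev, Sym2.mem_iff] at hw huniq
  obtain rfl | rfl := hw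
  · simpa using huniq (l := j - 1) (by simp)
  · simpa using huniq (l := j + 1) (by simp)

variable {r : ℕ} {C X : Set (ZMod r ⊕ ZMod r)}

/-- The set of edges at the rim vertex `i` of the wheel graph with `r` spokes. -/
def rimStar (i : ZMod r) : Set (ZMod r ⊕ ZMod r) := {f | some i ∈ wheelEnds r f}

lemma rimStar_add_one (i : ZMod r) :
    rimStar (i + 1) = {Sum.inr i, Sum.inl (i + 1), Sum.inr (i + 1)} := by
  ext (j | j)
  · simp [rimStar, wheelEnds, eq_comm]
  · simp [rimStar, wheelEnds, eq_comm, or_comm]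

/-- No rim vertex of the wheel graph has degree one in the subgraph with edge set `C`. This is the
property shared by the cycles of the wheel graph and the circuits of a cyclic fan. -/
def NoRimLeaf (C : Set (ZMod r ⊕ ZMod r)) : Prop :=
  ∀ (i : ZMod r) (f : ZMod r ⊕ ZMod r), C ∩ rimStar i ≠ {f}

/-- `C` contains two distinct spokes of the wheel graph and a rim path joining their ends. -/
def HasSpokeCycle (C : Set (ZMod r ⊕ ZMod r)) : Prop :=
  ∃ (i : ZMod r) (m : ℕ), 0 < m ∧ m < r ∧ Sum.inl i ∈ C ∧ Sum.inl (i + m) ∈ C ∧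
    ∀ l < m, Sum.inr (i + l) ∈ C

lemma HasSpokeCycle.mono (h : HasSpokeCycle C) (hCX : C ⊆ X) : HasSpokeCycle X := by
  obtain ⟨i, m, hm, hmr, hi, him, hrim⟩ := h
  exact ⟨i, m, hm, hmr, hCX hi, hCX him, fun l hl ↦ hCX (hrim l hl)⟩

lemma NoRimLeaf.exists_ne (h : NoRimLeaf C) {i : ZMod r} {f : ZMod r ⊕ ZMod r} (hf : f ∈ C)
    (hfi : f ∈ rimStar i) : ∃ g ∈ C, g ∈ rimStar i ∧ g ≠ f := by
  by_contra! hcon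
  exact h i f (subset_antisymm (fun g hg ↦ hcon g hg.1 hg.2) (singleton_subset_iff.2 ⟨hf, hfi⟩))

lemma NoRimLeaf.exists_inr_mem (h : NoRimLeaf C) (hC : C.Nonempty) : ∃ i, Sum.inr i ∈ C := by
  obtain ⟨i | i, hi⟩ := hC
  · obtain ⟨j, rfl⟩ : ∃ j, i = j + 1 := ⟨i - 1, by simp⟩
    obtain ⟨g, hgC, hgj, hg⟩ := h.exists_ne hi (i := j + 1) (by simp [rimStar_add_one])
    rw [rimStar_add_one] at hgj
    obtain rfl | rfl | rfl := hgj
    · exact ⟨j, hgC⟩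
    · exact (hg rfl).elim
    · exact ⟨j + 1, hgC⟩
  · exact ⟨i, hi⟩

lemma NoRimLeaf.inl_mem_of_inr_notMem (h : NoRimLeaf C) {i : ZMod r}
    (hi : Sum.inr i ∈ C ↔ Sum.inr (i + 1) ∉ C) : Sum.inl (i + 1) ∈ C := by
  have hstar (f) (hf : f ∈ C) (hfi : f ∈ rimStar (i + 1)) := h.exists_ne hf hfi
  simp only [rimStar_add_one, mem_insert_iff, mem_singleton_iff] at hstar
  by_cases hi' : Sum.inr i ∈ C <;> grind

lemma forall_zmod_of_add_one [NeZero r] {P : ZMod r → Prop} {i : ZMod r} (hi : P i)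
    (hadd : ∀ j, P j → P (j + 1)) (j : ZMod r) : P j := by
  have hnat (l : ℕ) : P (i + l) := by
    induction l with
    | zero => simpa using hi
    | succ l ih => simpa [add_assoc] using hadd _ ih
  simpa using hnat (j - i).val

lemma NoRimLeaf.rim_subset_or_hasSpokeCycle [NeZero r] (h : NoRimLeaf C) (hC : C.Nonempty) :
    range Sum.inr ⊆ C ∨ HasSpokeCycle C := by
  classical
  by_contra! hcon
  obtain ⟨hrim, hspoke⟩ := hcon
  rw [range_subset_iff, not_forall] at hrim
  obtain ⟨j, hj⟩ := hrim
  obtain ⟨i, hi, hi'⟩ : ∃ i, Sum.inr i ∉ C ∧ Sum.inr (i + 1) ∈ C := by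
    by_contra! hall
    obtain ⟨l, hl⟩ := h.exists_inr_mem hC
    exact forall_zmod_of_add_one (P := fun i ↦ Sum.inr i ∉ C) hj hall l hl
  have hend : ∃ l : ℕ, Sum.inr (i + 1 + l) ∉ C :=
    ⟨r - 1, by simpa [Nat.cast_sub (NeZero.one_le (n := r))] using hi⟩
  have hfind : Nat.find hend ≤ r - 1 :=
    Nat.find_le (by simpa [Nat.cast_sub (NeZero.one_le (n := r))] using hi)
  obtain ⟨m, hm⟩ : ∃ m, Nat.find hend = m + 1 := by
    refine Nat.exists_eq_succ_of_ne_zero fun h0 ↦ Nat.find_spec hend ?_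
    simpa [h0] using hi'
  have hpath (l : ℕ) (hl : l < m + 1) : Sum.inr (i + 1 + l) ∈ C :=
    not_not.1 (Nat.find_min hend (hm ▸ hl))
  have hlast : Sum.inr (i + 1 + (m + 1 : ℕ)) ∉ C := hm ▸ Nat.find_spec hend
  refine hspoke ⟨i + 1, m + 1, m.succ_pos, by have := NeZero.pos r; omega,
    h.inl_mem_of_inr_notMem (by simp [hi, hi']), ?_, hpath⟩
  rw [Nat.cast_succ, ← add_assoc] at hlast ⊢
  exact h.inl_mem_of_inr_notMem (by simp [hpath m m.lt_succ_self, hlast])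

lemma natCast_zmod_injOn : InjOn (Nat.cast : ℕ → ZMod r) (Iio r) := fun a ha b hb hab ↦ by
  rwa [ZMod.natCast_eq_natCast_iff', Nat.mod_eq_of_lt ha, Nat.mod_eq_of_lt hb] at hab

lemma isCycleEdgeSet_rim (hr : 2 ≤ r) : IsCycleEdgeSet (wheelEnds r) (range Sum.inr) :=
  ⟨r, by omega, some, Sum.inr, Option.some_injective _, Sum.inr_injective, rfl, fun _ ↦ rfl⟩

lemma HasSpokeCycle.exists_isCycleEdgeSet (h : HasSpokeCycle X) :
    ∃ C ⊆ X, IsCycleEdgeSet (wheelEnds r) C := by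
  obtain ⟨i, m, hm, hmr, hi, him, hrim⟩ := h
  have hinj : InjOn (fun l : ℕ ↦ (i + l : ZMod r)) (Iio r) :=
    (add_right_injective i).comp_injOn natCast_zmod_injOn
  let v : Fin (m + 2) → Option (ZMod r) := Fin.cons none fun j : Fin (m + 1) ↦ some (i + j.val)
  let e : Fin (m + 2) → ZMod r ⊕ ZMod r :=
    Fin.cons (Sum.inl i) (Fin.snoc (fun j : Fin m ↦ Sum.inr (i + j.val)) (Sum.inl (i + m)))
  have hends (j : Fin (m + 2)) : wheelEnds r (e j) = s(v j, v (j + 1)) := by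
    induction j using Fin.lastCases with
    | last =>
      rw [Fin.last_add_one, ← Fin.succ_last]
      simp [e, v, wheelEnds, Sym2.eq_swap]
    | cast j =>
      rw [Fin.coeSucc_eq_succ]
      induction j using Fin.cases with
      | zero => simp [e, v, wheelEnds]
      | succ j =>
        rw [← Fin.succ_castSucc]
        simp [e, v, wheelEnds, add_assoc]
  refine ⟨range e, ?_, m + 2, by omega, v, e, ?_, ?_, rfl, hends⟩
  · rw [range_subset_iff]
    refine Fin.cases hi (Fin.lastCases ?_ fun j ↦ ?_)
    · simpa [e] using him
    · simpa [e] using hrim j j.2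
  · refine Fin.cons_injective_iff.2 ⟨by simp, fun a b hab ↦ Fin.ext ?_⟩
    exact hinj (by simp; omega) (by simp; omega) (Option.some_injective _ hab)
  · refine Fin.cons_injective_iff.2 ⟨?_, Fin.snoc_injective_iff.2 ⟨fun a b hab ↦ Fin.ext ?_, ?_⟩⟩
    · rintro ⟨j, hj⟩
      induction j using Fin.lastCases with
      | last =>
        have := hinj hmr (hm.trans hmr) (by simpa using hj)
        omega
      | cast j => simp at hj
    · exact hinj (by simp; omega) (by simp; omega) (Sum.inr_injective hab)
    · simp

lemma not_isDiag_wheelEnds (hr : 2 ≤ r) (f : ZMod r ⊕ ZMod r) : ¬ (wheelEnds r f).IsDiag := by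
  have : Fact (1 < r) := ⟨hr⟩
  obtain j | j := f <;> simp [wheelEnds]

lemma isForest_wheelEnds_iff (hr : 2 ≤ r) :
    IsForest (wheelEnds r) X ↔ ¬ range Sum.inr ⊆ X ∧ ¬ HasSpokeCycle X := by
  have : NeZero r := ⟨by omega⟩
  refine ⟨fun h ↦ ⟨fun hX ↦ h _ hX (isCycleEdgeSet_rim hr), fun hX ↦ ?_⟩, fun h C hCX hC ↦ ?_⟩
  · obtain ⟨C, hCX, hC⟩ := hX.exists_isCycleEdgeSet
    exact h C hCX hC
  · have hleaf : NoRimLeaf C := fun i ↦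
      isCycleEdgeSet_inter_ne_singleton (not_isDiag_wheelEnds hr) hC (some i)
    have hne : C.Nonempty := by
      obtain ⟨n, -, v, e, -, -, rfl, -⟩ := hC
      exact range_nonempty e
    obtain h' | h' := hleaf.rim_subset_or_hasSpokeCycle hne
    · exact h.1 (h'.trans hCX)
    · exact h.2 (h'.mono hCX)

end Wheel

/-! ### Cyclic fans -/

/-- The elements of `M` are arranged cyclically as spokes `φ (inl i)` and rim elements `φ (inr i)`,
in the order `inl 0, inr 0, inl 1, inr 1, …`, so that the consecutive triples are alternately
triangles and triads. Wheels and whirls have such an arrangement; the converse is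
`IsCyclicFan.isWheel_or_isWhirl`. -/
structure IsCyclicFan (M : Matroid α) (r : ℕ) (φ : ZMod r ⊕ ZMod r → α) : Prop where
  two_le : 2 ≤ r
  injective : Function.Injective φ
  range_eq : range φ = M.E
  isTriangle : ∀ i, M.IsTriangle {φ (.inl i), φ (.inr i), φ (.inl (i + 1))}
  isTriad : ∀ i, M.IsTriad {φ (.inr i), φ (.inl (i + 1)), φ (.inr (i + 1))}

namespace IsCyclicFan

variable {r : ℕ} {φ : ZMod r ⊕ ZMod r → α} {S : Set (ZMod r ⊕ ZMod r)}

lemma dual (h : IsCyclicFan M r φ) :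
    IsCyclicFan M✶ r (Sum.elim (fun i ↦ φ (.inr i)) (fun i ↦ φ (.inl (i + 1)))) where
  two_le := h.two_le
  injective := by
    rintro (i | i) (j | j) hij <;> simpa using h.injective hij
  range_eq := by
    have hshift : range (fun i : ZMod r ↦ φ (.inl (i + 1))) = range (φ ∘ Sum.inl) :=
      (Equiv.addRight (1 : ZMod r)).surjective.range_comp (φ ∘ Sum.inl)
    rw [dual_ground, ← h.range_eq, Sum.elim_range, hshift, union_comm, ← Sum.elim_range,
      ← Sum.elim_comp_inl_inr φ]
    rfl
  isTriangle i := h.isTriad i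
  isTriad i := dual_isTriad.2 (h.isTriangle (i + 1))

lemma image_subset_ground (h : IsCyclicFan M r φ) (S : Set (ZMod r ⊕ ZMod r)) : φ '' S ⊆ M.E :=
  h.range_eq ▸ image_subset_range φ S

lemma noRimLeaf_of_isCircuit (h : IsCyclicFan M r φ) {C : Set α} (hC : M.IsCircuit C) :
    NoRimLeaf (φ ⁻¹' C) := by
  intro i f hf
  obtain ⟨j, rfl⟩ : ∃ j, i = j + 1 := ⟨i - 1, by simp⟩
  have hinter := congrArg (φ '' ·) hf
  simp only [rimStar_add_one, image_preimage_inter, image_insert_eq, image_singleton] at hinter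
  exact hC.inter_isCocircuit_ne_singleton (h.isTriad j).1 hinter

lemma rim_subset_or_hasSpokeCycle (h : IsCyclicFan M r φ) (hS : ¬ M.Indep (φ '' S)) :
    range Sum.inr ⊆ S ∨ HasSpokeCycle S := by
  have : NeZero r := ⟨by have := h.two_le; omega⟩
  obtain ⟨C, hCS, hC⟩ := Dep.exists_isCircuit_subset ⟨hS, h.image_subset_ground S⟩
  have hsub : φ ⁻¹' C ⊆ S := (preimage_mono hCS).trans (preimage_image_eq S h.injective).subset
  have hne : (φ ⁻¹' C).Nonempty :=
    hC.nonempty.preimage' (hC.subset_ground.trans h.range_eq.symm.subset)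
  exact ((h.noRimLeaf_of_isCircuit hC).rim_subset_or_hasSpokeCycle hne).imp
    hsub.trans' (·.mono hsub)

lemma not_indep_of_hasSpokeCycle (h : IsCyclicFan M r φ) (hS : HasSpokeCycle S) :
    ¬ M.Indep (φ '' S) := by
  obtain ⟨i, m, hm, hmr, hi, him, hrim⟩ := hS
  have hcl (n : ℕ) (hn : n ≤ m) :
      φ (.inl (i + n)) ∈ M.closure (φ '' (S \ {.inl (i + m)})) := by
    have hground := h.image_subset_ground (S \ {.inl (i + m)})
    induction n with
    | zero =>
      refine M.mem_closure_of_mem ⟨_, ⟨by simpa using hi, fun h0 ↦ hm.ne' ?_⟩, rfl⟩ hground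
      exact natCast_zmod_injOn hmr (mem_Iio.2 (hm.trans hmr)) (by simpa using h0)
    | succ n ih =>
      have hstep := IsTriangle.mem_closure (IsTriangle.swap (IsTriangle.swap_right
        (h.isTriangle (i + n))))
      rw [add_assoc, ← Nat.cast_succ] at hstep
      refine M.closure_subset_closure_of_subset_closure ?_ hstep
      rintro x (rfl | rfl)
      · exact ih (by omega)
      · exact M.mem_closure_of_mem ⟨_, ⟨hrim n (by omega), by simp⟩, rfl⟩ hground
  intro hind
  have hmem := hcl m le_rfl
  rw [image_sdiff h.injective, image_singleton] at hmem
  exact hind.notMem_closure_sdiff_of_mem ⟨_, him, rfl⟩ hmem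

lemma ground_subset_closure_spokes (h : IsCyclicFan M r φ) :
    M.E ⊆ M.closure (φ '' range Sum.inl) := by
  have hground := h.image_subset_ground (range Sum.inl)
  rw [← h.range_eq, range_subset_iff]
  rintro (i | i)
  · exact M.mem_closure_of_mem ⟨_, ⟨i, rfl⟩, rfl⟩ hground
  · refine M.closure_subset_closure ?_ (IsTriangle.mem_closure (IsTriangle.swap (h.isTriangle i)))
    rintro _ (rfl | rfl)
    exacts [⟨_, ⟨i, rfl⟩, rfl⟩, ⟨_, ⟨i + 1, rfl⟩, rfl⟩]

lemma isBase_rim (h : IsCyclicFan M r φ) (hI : M.Indep (φ '' range Sum.inr)) :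
    M.IsBase (φ '' range Sum.inr) := by
  have : NeZero r := ⟨by have := h.two_le; omega⟩
  have hcard : (φ '' range Sum.inl).encard = (φ '' range Sum.inr).encard := by
    simp only [h.injective.encard_image, ← image_univ, Sum.inl_injective.encard_image,
      Sum.inr_injective.encard_image]
  refine hI.isBase_of_eRk_ge (toFinite _) ?_
  calc M.eRank = M.eRk M.E := M.eRk_ground.symm
    _ ≤ M.eRk (M.closure (φ '' range Sum.inl)) := M.eRk_mono h.ground_subset_closure_spokes
    _ = M.eRk (φ '' range Sum.inl) := M.eRk_closure_eq _
    _ ≤ (φ '' range Sum.inl).encard := M.eRk_le_encard _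
    _ = M.eRk (φ '' range Sum.inr) := by rw [hcard, hI.eRk_eq_encard]

lemma indep_of_isForest (h : IsCyclicFan M r φ) (hS : IsForest (wheelEnds r) S) :
    M.Indep (φ '' S) := by
  rw [isForest_wheelEnds_iff h.two_le] at hS
  by_contra hcon
  exact (h.rim_subset_or_hasSpokeCycle hcon).elim hS.1 hS.2

lemma isForest_of_indep (h : IsCyclicFan M r φ) (hS : M.Indep (φ '' S))
    (hrim : ¬ range Sum.inr ⊆ S) : IsForest (wheelEnds r) S :=
  (isForest_wheelEnds_iff h.two_le).2 ⟨hrim, fun hs ↦ h.not_indep_of_hasSpokeCycle hs hS⟩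

theorem isWheel_or_isWhirl (h : IsCyclicFan M r φ) : M.IsWheel ∨ M.IsWhirl := by
  by_cases hrim : M.Indep (φ '' range Sum.inr)
  · refine .inr ⟨r, h.two_le, φ, h.injective, h.range_eq, fun S ↦ ⟨fun hS ↦ ?_, ?_⟩⟩
    · refine or_iff_not_imp_right.2 fun hne ↦ h.isForest_of_indep hS fun hrS ↦ hne ?_
      exact (image_injective.2 h.injective
        ((h.isBase_rim hrim).eq_of_subset_indep hS (image_mono hrS))).symm
    · rintro (hS | rfl)
      exacts [h.indep_of_isForest hS, hrim]
  · refine .inl ⟨r, h.two_le, φ, h.injective, h.range_eq, fun S ↦ ⟨fun hS ↦ ?_,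
      h.indep_of_isForest⟩⟩
    exact h.isForest_of_indep hS fun hrS ↦ hrim (hS.subset (image_mono hrS))

end IsCyclicFan

lemma exists_isCyclicFan_dual_iff :
    (∃ r φ, IsCyclicFan M✶ r φ) ↔ ∃ r φ, IsCyclicFan M r φ :=
  ⟨fun ⟨r, _, h⟩ ↦ ⟨r, _, by simpa only [dual_dual] using h.dual⟩, fun ⟨r, _, h⟩ ↦ ⟨r, _, h.dual⟩⟩
/-! ### Deleting an element -/

/-- `(X, Y)` is a partition of `E(M) - a` that is a `k`-separation of `M ＼ {a}` if the deletion of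
`a` leaves the rank unchanged. The ranks are those of `M`, which saves restating them when elements
move between the two sides. -/
structure IsDeleteSeparation (M : Matroid α) (k : ℕ) (a : α) (X Y : Set α) : Prop where
  union_eq : X ∪ Y = M.E \ {a}
  disjoint : Disjoint X Y
  le_left : k ≤ X.ncard
  le_right : k ≤ Y.ncard
  rk_lt : rk M X + rk M Y < rk M M.E + k

namespace IsDeleteSeparation

lemma symm (h : IsDeleteSeparation M k a X Y) : IsDeleteSeparation M k a Y X where
  union_eq := union_comm X Y ▸ h.union_eq
  disjoint := h.disjoint.symm
  le_left := h.le_right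
  le_right := h.le_left
  rk_lt := by simpa only [add_comm] using h.rk_lt

lemma left_subset (h : IsDeleteSeparation M k a X Y) : X ⊆ M.E \ {a} :=
  h.union_eq ▸ subset_union_left

lemma left_subset_ground (h : IsDeleteSeparation M k a X Y) : X ⊆ M.E :=
  h.left_subset.trans sdiff_subset

lemma mem_or_mem (h : IsDeleteSeparation M k a X Y) (he : e ∈ M.E) (hea : e ≠ a) :
    e ∈ X ∨ e ∈ Y := by
  have : e ∈ X ∪ Y := h.union_eq ▸ ⟨he, hea⟩
  exact this

lemma sdiff_insert_eq (h : IsDeleteSeparation M k a X Y) : M.E \ insert a X = Y := by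
  rw [← singleton_union, ← sdiff_sdiff, ← h.union_eq, union_sdiff_left, h.disjoint.sdiff_eq_right]

lemma notMem_closure [M.Finite] (h : IsDeleteSeparation M k a X Y)
    (hM : M.IsKConnected (k + 1)) (ha : a ∈ M.E) : a ∉ M.closure X := by
  intro hcl
  have hXfin := M.ground_finite.subset h.left_subset_ground
  have hsep := isKConnected_iff_rk.1 hM k k.lt_succ_self (insert a X)
    (insert_subset ha h.left_subset_ground)
    (h.le_left.trans (ncard_le_ncard (subset_insert a X) (hXfin.insert a)))
    (by rw [h.sdiff_insert_eq]; exact h.le_right)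
  rw [h.sdiff_insert_eq, rk_insert_of_mem_closure hcl] at hsep
  exact hsep.not_gt h.rk_lt

lemma insert_sdiff [M.Finite] (h : IsDeleteSeparation M k a X Y) (hc : c ∈ Y)
    (hcl : c ∉ M.closure (Y \ {c})) (hk : k ≤ (Y \ {c}).ncard) :
    IsDeleteSeparation M k a (insert c X) (Y \ {c}) where
  union_eq := by
    rw [insert_union, ← union_insert, insert_sdiff_singleton, insert_eq_of_mem hc, h.union_eq]
  disjoint := by
    rw [disjoint_insert_left]
    exact ⟨fun hcY ↦ hcY.2 rfl, h.disjoint.mono_right sdiff_subset⟩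
  le_left := h.le_left.trans (ncard_le_ncard (subset_insert c X)
    ((M.ground_finite.subset h.left_subset_ground).insert c))
  le_right := hk
  rk_lt := by
    have hY := rk_insert_of_notMem_closure (h.symm.left_subset_ground hc) hcl
    rw [insert_sdiff_singleton, insert_eq_of_mem hc] at hY
    have hX := rk_insert_le (M := M) c X
    have := h.rk_lt
    omega

end IsDeleteSeparation

lemma IsKConnected.exists_isDeleteSeparation [M.Finite] (hM : M.IsKConnected (k + 1))
    (hE : 2 * k ≤ M.E.ncard) (ha : a ∈ M.E) (hdel : ¬ (M ＼ {a}).IsKConnected (k + 1)) :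
    ∃ X Y, IsDeleteSeparation M k a X Y := by
  rw [isKConnected_iff_rk] at hdel
  push Not at hdel
  obtain ⟨j, hj, X, hX, hjX, hjY, hlt⟩ := hdel
  rw [delete_ground] at hX hjY hlt
  rw [rk_delete_of_subset subset_rfl, rk_delete_of_subset hX, rk_delete_of_subset sdiff_subset]
    at hlt
  have hrk : rk M (M.E \ {a}) ≤ rk M M.E := rk_mono sdiff_subset
  obtain rfl | hjk := (Nat.le_of_lt_succ hj).eq_or_lt
  · exact ⟨X, (M.E \ {a}) \ X, union_sdiff_cancel hX, disjoint_sdiff_right, hjX, hjY, by omega⟩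
  have hcard := ncard_sdiff_add_ncard_of_subset hX M.ground_finite.sdiff
  have hcarda := ncard_sdiff_singleton_add_one ha M.ground_finite
  have hadd {Z : Set α} (hZ : Z ⊆ M.E \ {a}) (hjZ : j ≤ Z.ncard)
      (hjZ' : j + 1 ≤ ((M.E \ {a}) \ Z).ncard) :
      rk M M.E + j ≤ rk M Z + rk M ((M.E \ {a}) \ Z) := by
    have hcompl : M.E \ insert a Z = (M.E \ {a}) \ Z := by
      rw [sdiff_sdiff, singleton_union]
    have hsep := isKConnected_iff_rk.1 hM (j + 1) (by omega) (insert a Z)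
      (insert_subset ha (hZ.trans sdiff_subset))
      (by rw [ncard_insert_of_notMem (fun haZ ↦ (hZ haZ).2 rfl)
        (M.ground_finite.subset (hZ.trans sdiff_subset))]; omega) (hcompl ▸ hjZ')
    rw [hcompl] at hsep
    have := rk_insert_le (M := M) a Z
    omega
  obtain hjY' | hjX' : j + 1 ≤ ((M.E \ {a}) \ X).ncard ∨ j + 1 ≤ X.ncard := by omega
  · have := hadd hX hjX hjY'
    omega
  · have := hadd sdiff_subset hjY (by rwa [sdiff_sdiff_cancel_left hX])
    rw [sdiff_sdiff_cancel_left hX] at this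
    omega

lemma notMem_closure_sdiff_of_isCocircuit {K : Set α} (hK : M.IsCocircuit K) (hYK : Y ∩ K = {c}) :
    c ∉ M.closure (Y \ {c}) := by
  intro hcl
  have hc : c ∈ Y ∩ K := hYK ▸ mem_singleton c
  obtain ⟨C, hCY, hC, hcC⟩ := exists_isCircuit_of_mem_closure hcl (fun hcY ↦ hcY.2 rfl)
  rw [insert_sdiff_singleton, insert_eq_of_mem hc.1] at hCY
  refine hC.inter_isCocircuit_ne_singleton hK (e := c) (subset_antisymm ?_ ?_)
  · exact hYK ▸ inter_subset_inter_left K hCY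
  · exact singleton_subset_iff.2 ⟨hcC, hc.2⟩

section ThreeConnected

variable [M.Finite]

lemma IsDeleteSeparation.exists_isTriad (h : IsDeleteSeparation M 2 a X Y)
    (hM : M.IsKConnected 3) (hE : 4 ≤ M.E.ncard) (hT : M.IsTriangle {a, b, c})
    (hK : M.IsTriad {b, c, d}) (hb : b ∈ X) (hc : c ∈ Y) (hd : d ∈ X) :
    ∃ y ∉ ({a, b, c, d} : Set α), M.IsTriad {a, c, y} := by
  have ha : a ∈ M.E := IsTriangle.subset_ground hT (by simp)
  have hXY {e} (heX : e ∈ X) (heY : e ∈ Y) : False := h.disjoint.notMem_of_mem_left heX heY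
  have hcl : c ∉ M.closure (Y \ {c}) := by
    refine notMem_closure_sdiff_of_isCocircuit hK.1 (subset_antisymm ?_ ?_)
    · rintro e ⟨heY, rfl | rfl | rfl⟩
      exacts [(hXY hb heY).elim, rfl, (hXY hd heY).elim]
    · exact singleton_subset_iff.2 ⟨hc, by simp⟩
  have hsmall : (Y \ {c}).ncard < 2 := by
    by_contra! h2
    refine (h.insert_sdiff hc hcl h2).notMem_closure hM ha ?_
    refine mem_of_mem_of_subset (IsTriangle.mem_closure hT) (M.closure_subset_closure ?_)
    exact pair_subset (mem_insert_of_mem c hb) (mem_insert c X)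
  have hYE := h.symm.left_subset_ground
  have hcard := ncard_sdiff_singleton_add_one hc (M.ground_finite.subset hYE)
  have hle := h.le_right
  obtain ⟨y, hy⟩ := ncard_eq_one.1 (show (Y \ {c}).ncard = 1 by omega)
  obtain ⟨hyY, hyc⟩ : y ∈ Y \ {c} := hy ▸ mem_singleton y
  have hYeq : Y = {c, y} := by
    rw [← insert_eq_of_mem hc, ← insert_sdiff_singleton, hy]
  have hya : y ≠ a := (h.symm.left_subset hyY).2
  refine ⟨y, ?_, IsKConnected.isTriad_of_rk_lt hM hE (hYeq ▸ insert_subset ha hYE) ?_ ?_⟩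
  · rintro (rfl | rfl | rfl | rfl)
    exacts [hya rfl, hXY hb hyY, hyc rfl, hXY hd hyY]
  · exact ncard_eq_three.2 ⟨a, c, y, (IsTriangle.ne hT).2.1, hya.symm, Ne.symm hyc, rfl⟩
  · have hind := IsKConnected.indep_of_ncard_lt hM hE hYE (by omega)
    rw [indep_iff_rk_eq_ncard (M.ground_finite.subset hYE)] at hind
    have := h.rk_lt
    rw [← hYeq, h.symm.sdiff_insert_eq]
    omega

lemma IsKConnected.exists_isTriad_of_not_delete (hM : M.IsKConnected 3) (hE : 4 ≤ M.E.ncard)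
    (hT : M.IsTriangle {a, b, c}) (hK : M.IsTriad {b, c, d}) (had : a ≠ d)
    (hdel : ¬ (M ＼ {a}).IsKConnected 3) :
    ∃ y ∉ ({a, b, c, d} : Set α), M.IsTriad {a, b, y} ∨ M.IsTriad {a, c, y} := by
  obtain ⟨hab, hac, -⟩ := IsTriangle.ne hT
  have ha : a ∈ M.E := IsTriangle.subset_ground hT (by simp)
  obtain ⟨X, Y, h⟩ := IsKConnected.exists_isDeleteSeparation hM hE ha hdel
  wlog hbX : b ∈ X generalizing X Y
  · exact this Y X h.symm ((h.mem_or_mem (IsTriangle.subset_ground hT (by simp))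
      hab.symm).resolve_left hbX)
  have hcY : c ∈ Y := by
    refine (h.mem_or_mem (IsTriangle.subset_ground hT (by simp)) hac.symm).resolve_left fun hcX ↦ ?_
    exact h.notMem_closure hM ha
      (M.closure_subset_closure (pair_subset hbX hcX) (IsTriangle.mem_closure hT))
  obtain hdX | hdY := h.mem_or_mem (IsTriad.subset_ground hK (by simp)) had.symm
  · obtain ⟨y, hy, hty⟩ := h.exists_isTriad hM hE hT hK hbX hcY hdX
    exact ⟨y, hy, .inr hty⟩
  · obtain ⟨y, hy, hty⟩ := h.symm.exists_isTriad hM hE (IsTriangle.swap_right hT)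
      (IsTriad.swap hK) hcY hbX hdY
    exact ⟨y, insert_comm b c {d} ▸ hy, .inl hty⟩

end ThreeConnected

/-! ### Alternating fans -/

/-- The first `k` terms of the sequence `x` are distinct, and the consecutive triples among them
are alternately triangles and triads, beginning with a triangle. The terms of `x` from `x k` on are
irrelevant; indexing by `ℕ` avoids arithmetic in `Fin k`. -/
structure IsAltFan (M : Matroid α) (k : ℕ) (x : ℕ → α) : Prop where
  injOn : InjOn x (Iio k)
  isTriangle : ∀ i, i + 2 < k → Even i → M.IsTriangle {x i, x (i + 1), x (i + 2)}
  isTriad : ∀ i, i + 2 < k → Odd i → M.IsTriad {x i, x (i + 1), x (i + 2)}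

lemma range_sumElim_even_odd (m : ℕ) (x : ℕ → α) :
    range (Sum.elim (fun i : Fin (m + 1) ↦ x (2 * i)) (fun i : Fin (m + 1) ↦ x (2 * i + 1))) =
      x '' Iio (2 * m + 2) := by
  rw [Sum.elim_range]
  refine subset_antisymm (union_subset ?_ ?_) ?_
  · rintro _ ⟨i, rfl⟩
    exact ⟨2 * i.val, show 2 * i.val < 2 * m + 2 by have := i.2; omega, rfl⟩
  · rintro _ ⟨i, rfl⟩
    exact ⟨2 * i.val + 1, show 2 * i.val + 1 < 2 * m + 2 by have := i.2; omega, rfl⟩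
  · rintro _ ⟨n, hn, rfl⟩
    rw [mem_Iio] at hn
    obtain ⟨j, rfl | rfl⟩ := Nat.even_or_odd' n
    · exact .inl ⟨⟨j, by omega⟩, rfl⟩
    · exact .inr ⟨⟨j, by omega⟩, rfl⟩

namespace IsAltFan

variable {x : ℕ → α} {m n : ℕ} {C : Set α}

lemma ne (h : IsAltFan M k x) {i j : ℕ} (hi : i < k) (hj : j < k) (hij : i ≠ j) : x i ≠ x j :=
  fun hx ↦ hij (h.injOn hi hj hx)

lemma mono (h : IsAltFan M k x) (hn : n ≤ k) : IsAltFan M n x where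
  injOn := h.injOn.mono (Iio_subset_Iio hn)
  isTriangle i hi := h.isTriangle i (hi.trans_le hn)
  isTriad i hi := h.isTriad i (hi.trans_le hn)

lemma triple_subset_ground (h : IsAltFan M k x) {i : ℕ} (hi : i + 2 < k) :
    {x i, x (i + 1), x (i + 2)} ⊆ M.E :=
  (Nat.even_or_odd i).elim (fun hp ↦ IsTriangle.subset_ground (h.isTriangle i hi hp))
    fun hp ↦ IsTriad.subset_ground (h.isTriad i hi hp)

lemma mem_ground (h : IsAltFan M k x) (hk : 3 ≤ k) {i : ℕ} (hi : i < k) : x i ∈ M.E := by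
  obtain ⟨j, hj, hij⟩ : ∃ j, j + 2 < k ∧ (i = j ∨ i = j + 1 ∨ i = j + 2) :=
    ⟨min i (k - 3), by omega, by omega⟩
  obtain rfl | rfl | rfl := hij <;> exact h.triple_subset_ground hj (by simp)

lemma image_subset_ground (h : IsAltFan M k x) (hk : 3 ≤ k) : x '' Iio k ⊆ M.E := by
  rintro _ ⟨i, hi, rfl⟩
  exact h.mem_ground hk hi

lemma ncard_image (h : IsAltFan M k x) : (x '' Iio k).ncard = k := by
  rw [h.injOn.ncard_image, ncard_eq_toFinset_card', toFinset_Iio, Nat.card_Iio]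

lemma le_ncard_ground [M.Finite] (h : IsAltFan M k x) (hk : 3 ≤ k) : k ≤ M.E.ncard :=
  h.ncard_image.ge.trans (ncard_le_ncard (h.image_subset_ground hk) M.ground_finite)

lemma cons (h : IsAltFan M k x) {y : α} (hy : y ∉ x '' Iio k) (hT : M.IsTriad {y, x 0, x 1}) :
    IsAltFan M✶ (k + 1) (fun n ↦ Nat.casesOn n y x) where
  injOn := by
    rintro (_ | i) hi (_ | j) hj hij
    · rfl
    · exact (hy ⟨j, by simpa using hj, hij.symm⟩).elim
    · exact (hy ⟨i, by simpa using hi, hij⟩).elim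
    · rw [h.injOn (by simpa using hi) (by simpa using hj) hij]
  isTriangle := by
    rintro (_ | i) hi hp
    · exact hT
    · exact h.isTriad i (by omega) (by grind)
  isTriad := by
    rintro (_ | i) hi hp
    · simp at hp
    · exact dual_isTriad.2 (h.isTriangle i (by omega) (by grind))

lemma image_cons (x : ℕ → α) (y : α) (k : ℕ) :
    (fun n ↦ (Nat.casesOn n y x : α)) '' Iio (k + 1) = insert y (x '' Iio k) := by
  ext z
  constructor
  · rintro ⟨_ | i, hi, rfl⟩
    · exact .inl rfl
    · exact .inr ⟨i, by simpa using hi, rfl⟩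
  · rintro (rfl | ⟨i, hi, rfl⟩)
    · exact ⟨0, by simp, rfl⟩
    · exact ⟨i + 1, by simpa using hi, rfl⟩

lemma injOn_reverse (h : IsAltFan M k x) : InjOn (fun n ↦ x (k - 1 - n)) (Iio k) := by
  intro i hi j hj hij
  rw [mem_Iio] at hi hj
  have := h.injOn (show k - 1 - i < k by omega) (show k - 1 - j < k by omega) hij
  omega

lemma reverse_triple (x : ℕ → α) {i : ℕ} (hi : i + 2 < k) :
    ({x (k - 1 - i), x (k - 1 - (i + 1)), x (k - 1 - (i + 2))} : Set α) =
      {x (k - 3 - i), x (k - 3 - i + 1), x (k - 3 - i + 2)} := by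
  rw [show k - 1 - i = k - 3 - i + 2 by omega, show k - 1 - (i + 1) = k - 3 - i + 1 by omega,
    show k - 1 - (i + 2) = k - 3 - i by omega]
  grind

lemma reverse_of_odd (h : IsAltFan M k x) (hk : Odd k) :
    IsAltFan M k (fun n ↦ x (k - 1 - n)) where
  injOn := h.injOn_reverse
  isTriangle i hi hp := reverse_triple x hi ▸ h.isTriangle (k - 3 - i) (by omega) (by grind)
  isTriad i hi hp := reverse_triple x hi ▸ h.isTriad (k - 3 - i) (by omega) (by grind)

lemma reverse_of_even (h : IsAltFan M k x) (hk : Even k) :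
    IsAltFan M✶ k (fun n ↦ x (k - 1 - n)) where
  injOn := h.injOn_reverse
  isTriangle i hi hp := reverse_triple x hi ▸ h.isTriad (k - 3 - i) (by omega) (by grind)
  isTriad i hi hp := dual_isTriad.2 <|
    reverse_triple x hi ▸ h.isTriangle (k - 3 - i) (by omega) (by grind)

lemma image_reverse (x : ℕ → α) (k : ℕ) : (fun n ↦ x (k - 1 - n)) '' Iio k = x '' Iio k := by
  have hsub (y : ℕ → α) : (fun n ↦ y (k - 1 - n)) '' Iio k ⊆ y '' Iio k := by
    rintro _ ⟨i, hi, rfl⟩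
    rw [mem_Iio] at hi
    exact ⟨k - 1 - i, show k - 1 - i < k by omega, rfl⟩
  refine (hsub x).antisymm ?_
  rintro _ ⟨i, hi, rfl⟩
  rw [mem_Iio] at hi
  exact ⟨k - 1 - i, show k - 1 - i < k by omega, congrArg x (by omega)⟩

lemma mem_closure_even (h : IsAltFan M (2 * m + 1) x) (hm : 1 ≤ m) (hn : n < 2 * m + 1) :
    x n ∈ M.closure ((fun i ↦ x (2 * i)) '' Iic m) := by
  have hground : (fun i ↦ x (2 * i)) '' Iic m ⊆ M.E := by
    rintro _ ⟨i, hi, rfl⟩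
    rw [mem_Iic] at hi
    exact h.mem_ground (by omega) (by omega)
  obtain ⟨j, rfl | rfl⟩ := Nat.even_or_odd' n
  · exact M.mem_closure_of_mem ⟨j, show j ≤ m by omega, rfl⟩ hground
  · refine M.closure_subset_closure (pair_subset ?_ ?_)
      (IsTriangle.mem_closure (IsTriangle.swap (h.isTriangle (2 * j) (by omega) (by simp))))
    · exact ⟨j, show j ≤ m by omega, rfl⟩
    · exact ⟨j + 1, show j + 1 ≤ m by omega, rfl⟩

lemma mem_dual_closure_odd (h : IsAltFan M (2 * m + 2) x) (hm : 1 ≤ m)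
    (hlast : M.IsTriad {x (2 * m + 1), x 0, x 1}) (hn : n < 2 * m + 2) :
    x n ∈ M✶.closure ((fun i ↦ x (2 * i + 1)) '' Iic m) := by
  have hground : (fun i ↦ x (2 * i + 1)) '' Iic m ⊆ M✶.E := by
    rintro _ ⟨i, hi, rfl⟩
    rw [mem_Iic] at hi
    exact h.mem_ground (by omega) (by omega)
  obtain ⟨_ | j, rfl | rfl⟩ := Nat.even_or_odd' n
  · refine M✶.closure_subset_closure (pair_subset ?_ ?_)
      (IsTriangle.mem_closure (IsTriangle.swap hlast))
    · exact ⟨m, mem_Iic.2 le_rfl, rfl⟩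
    · exact ⟨0, mem_Iic.2 m.zero_le, rfl⟩
  · exact M✶.mem_closure_of_mem ⟨0, mem_Iic.2 m.zero_le, rfl⟩ hground
  · refine M✶.closure_subset_closure (pair_subset ?_ ?_)
      (IsTriangle.mem_closure (IsTriangle.swap (h.isTriad (2 * j + 1) (by omega) (by simp))))
    · exact ⟨j, show j ≤ m by omega, rfl⟩
    · exact ⟨j + 1, show j + 1 ≤ m by omega, rfl⟩
  · exact M✶.mem_closure_of_mem ⟨j + 1, show j + 1 ≤ m by omega, rfl⟩ hground

lemma rk_image_Iic_le [M.RankFinite] (f : ℕ → α) (m : ℕ) : rk M (f '' Iic m) ≤ m + 1 := by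
  refine (rk_le_ncard ((finite_Iic m).image f)).trans ((ncard_image_le (finite_Iic m)).trans ?_)
  rw [ncard_eq_toFinset_card', toFinset_Iic, Nat.card_Iic]

lemma rk_image_odd_le [M.RankFinite] (h : IsAltFan M (2 * m + 1) x) (hm : 1 ≤ m) :
    rk M (x '' Iio (2 * m + 1)) ≤ m + 1 := by
  refine (rk_le_of_subset_closure ?_).trans (rk_image_Iic_le (fun i ↦ x (2 * i)) m)
  rintro _ ⟨n, hn, rfl⟩
  exact h.mem_closure_even hm hn

lemma rk_image_even_le [M.RankFinite] (h : IsAltFan M (2 * m + 2) x) (hm : 1 ≤ m) :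
    rk M (x '' Iio (2 * m + 2)) ≤ m + 2 := by
  have hIio : Iio (2 * m + 2) = insert (2 * m + 1) (Iio (2 * m + 1)) := by grind
  rw [hIio, image_insert_eq]
  exact (rk_insert_le _ _).trans
    (Nat.succ_le_succ ((h.mono (Nat.le_succ _)).rk_image_odd_le hm))

lemma rk_dual_image_le [M✶.RankFinite] (h : IsAltFan M (2 * m + 2) x) (hm : 1 ≤ m)
    (hlast : M.IsTriad {x (2 * m + 1), x 0, x 1}) :
    rk M✶ (x '' Iio (2 * m + 2)) ≤ m + 1 := by
  refine (rk_le_of_subset_closure ?_).trans (rk_image_Iic_le (fun i ↦ x (2 * i + 1)) m)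
  rintro _ ⟨n, hn, rfl⟩
  exact h.mem_dual_closure_odd hm hlast hn

lemma notMem_isCocircuit_of_odd (h : IsAltFan M (2 * m + 2) x) (hC : M.IsCocircuit C)
    (heven : ∀ i ≤ m, x (2 * i) ∉ C) {i : ℕ} (hi : i < m) : x (2 * i + 1) ∉ C := fun hiC ↦
  (IsTriangle.mem_or_mem (IsTriangle.swap (h.isTriangle (2 * i) (by omega) (by simp))) hC hiC).elim
    (heven i hi.le) (heven (i + 1) hi)

lemma notMem_isCircuit_of_even (h : IsAltFan M (2 * m + 2) x) (hC : M.IsCircuit C)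
    (hodd : ∀ i < m, x (2 * i + 1) ∉ C) {i : ℕ} (hi : i + 1 < m) : x (2 * (i + 1)) ∉ C := fun hiC ↦
  (IsTriad.mem_or_mem (IsTriad.swap (h.isTriad (2 * i + 1) (by omega) (by simp))) hC hiC).elim
    (hodd i (by omega)) (hodd (i + 1) hi)

variable [M.Finite]

lemma ground_eq (hM : M.IsKConnected 3) (h : IsAltFan M (2 * m + 2) x) (hm : 1 ≤ m)
    (hlast : M.IsTriad {x (2 * m + 1), x 0, x 1}) : M.E = x '' Iio (2 * m + 2) := by
  have hFE := h.image_subset_ground (by omega)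
  have hE : 4 ≤ M.E.ncard := (by omega : 4 ≤ 2 * m + 2).trans (h.le_ncard_ground (by omega))
  have hF := h.ncard_image
  have hrk := h.rk_image_even_le hm
  have hrkdual := h.rk_dual_image_le hm hlast
  have hsmall : (M.E \ x '' Iio (2 * m + 2)).ncard < 2 :=
    IsKConnected.ncard_sdiff_lt hM (by omega) hFE (by omega) (by omega)
  refine subset_antisymm (fun z hz ↦ ?_) hFE
  by_contra hzF
  have hFcl : x '' Iio (2 * m + 2) ⊆ M✶.closure ((fun i ↦ x (2 * i + 1)) '' Iic m) := by
    rintro _ ⟨n, hn, rfl⟩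
    exact h.mem_dual_closure_odd hm hlast hn
  have hzcl : z ∈ M✶.closure ((fun i ↦ x (2 * i + 1)) '' Iic m) :=
    M✶.closure_subset_closure_of_subset_closure hFcl
      (IsKConnected.mem_closure_of_ncard_sdiff_lt (IsKConnected.dual hM) hE hFE
        (hsmall.trans (by omega)) hz)
  obtain ⟨C, hCsub, hC, -⟩ := exists_isCircuit_of_mem_closure hzcl fun ⟨i, hi, hiz⟩ ↦
    hzF ⟨2 * i + 1, by rw [mem_Iic] at hi; rw [mem_Iio]; omega, hiz⟩
  have heven (i : ℕ) (hi : i ≤ m) : x (2 * i) ∉ C := by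
    intro hiC
    obtain hiz | ⟨j, hj, hji⟩ := hCsub hiC
    · exact hzF ⟨2 * i, show 2 * i < 2 * m + 2 by omega, hiz⟩
    · rw [mem_Iic] at hj
      exact h.ne (by omega) (by omega) (by omega) hji
  have hCpair : C ⊆ {z, x (2 * m + 1)} := by
    intro y hy
    obtain rfl | ⟨i, hi, rfl⟩ := hCsub hy
    · exact mem_insert _ _
    · obtain rfl | hlt := (mem_Iic.1 hi).eq_or_lt
      · exact mem_insert_of_mem _ rfl
      · exact (h.notMem_isCocircuit_of_odd hC heven hlt hy).elim
  have hC3 := IsKConnected.le_ncard_of_isCircuit (IsKConnected.dual hM) hE hC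
  have := (ncard_le_ncard hCpair).trans (ncard_insert_le z {x (2 * m + 1)})
  rw [ncard_singleton] at this
  omega

lemma isTriangle_last (hM : M.IsKConnected 3) (h : IsAltFan M (2 * m + 2) x) (hm : 1 ≤ m)
    (hE : M.E = x '' Iio (2 * m + 2)) : M.IsTriangle {x (2 * m), x (2 * m + 1), x 0} := by
  have hE4 : 4 ≤ M.E.ncard := (by omega : 4 ≤ 2 * m + 2).trans (h.le_ncard_ground (by omega))
  have hcard : ({x (2 * m), x (2 * m + 1), x 0} : Set α).ncard = 3 :=
    ncard_eq_three.2 ⟨_, _, _, h.ne (by omega) (by omega) (by omega),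
      h.ne (by omega) (by omega) (by omega), h.ne (by omega) (by omega) (by omega), rfl⟩
  have hcl : x (2 * m + 1) ∈ M.closure ((fun i ↦ x (2 * i)) '' Iic m) := by
    have hlastE := h.mem_ground (by omega) (Nat.lt_succ_self _)
    have hsmall : (M.E \ (M.E \ {x (2 * m + 1)})).ncard < 2 := by
      rw [sdiff_sdiff_cancel_left (singleton_subset_iff.2 hlastE), ncard_singleton]
      omega
    refine M.closure_subset_closure_of_subset_closure ?_
      (IsKConnected.mem_closure_of_ncard_sdiff_lt hM hE4 (X := M.E \ {x (2 * m + 1)})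
        sdiff_subset (by omega) hlastE)
    rw [hE]
    rintro _ ⟨⟨n, hn, rfl⟩, hne⟩
    rw [mem_Iio] at hn
    exact (h.mono (Nat.le_succ _)).mem_closure_even hm
      (lt_of_le_of_ne (by omega) fun hn' ↦ hne (hn' ▸ rfl))
  obtain ⟨C, hCsub, hC, -⟩ := exists_isCircuit_of_mem_closure hcl fun ⟨i, hi, hiz⟩ ↦
    h.ne (by rw [mem_Iic] at hi; omega) (by omega) (by omega) hiz
  have hodd (i : ℕ) (hi : i < m) : x (2 * i + 1) ∉ C := by
    intro hiC
    obtain hi' | ⟨j, hj, hji⟩ := hCsub hiC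
    · exact h.ne (by omega) (by omega) (by omega) hi'
    · rw [mem_Iic] at hj
      exact h.ne (by omega) (by omega) (by omega) hji
  refine IsKConnected.isTriangle_of_isCircuit_subset hM hE4 hC (fun y hy ↦ ?_) hcard
  obtain rfl | ⟨_ | i, hi, rfl⟩ := hCsub hy
  · simp
  · simp
  · obtain rfl | hlt := (mem_Iic.1 hi).eq_or_lt
    · simp
    · exact (h.notMem_isCircuit_of_even hC hodd hlt hy).elim

lemma isCyclicFan (hM : M.IsKConnected 3) (h : IsAltFan M (2 * m + 2) x) (hm : 1 ≤ m)
    (hlast : M.IsTriad {x (2 * m + 1), x 0, x 1}) :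
    IsCyclicFan M (m + 1) (Sum.elim (fun i : Fin (m + 1) ↦ x (2 * i))
      (fun i : Fin (m + 1) ↦ x (2 * i + 1))) where
  two_le := by omega
  injective := by
    refine Function.Injective.sumElim (fun i j hij ↦ ?_) (fun i j hij ↦ ?_) fun i j ↦
      h.ne (by have := i.2; omega) (by have := j.2; omega) (by omega)
    all_goals
      have hi := i.2
      have hj := j.2
      by_contra hne
      exact h.ne (by omega) (by omega) (fun h' ↦ hne (Fin.ext (by omega))) hij
  range_eq := by
    rw [h.ground_eq hM hm hlast]
    exact range_sumElim_even_odd m x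
  isTriangle := by
    change ∀ i : Fin (m + 1), M.IsTriangle {x (2 * i), x (2 * i + 1), x (2 * (i + 1 : Fin (m + 1)))}
    refine Fin.lastCases ?_ fun i ↦ ?_
    · rw [Fin.last_add_one]
      exact h.isTriangle_last hM hm (h.ground_eq hM hm hlast)
    · rw [Fin.coeSucc_eq_succ]
      exact h.isTriangle (2 * i) (by omega) (by simp)
  isTriad := by
    change ∀ i : Fin (m + 1), M.IsTriad
      {x (2 * i + 1), x (2 * (i + 1 : Fin (m + 1))), x (2 * (i + 1 : Fin (m + 1)) + 1)}
    refine Fin.lastCases ?_ fun i ↦ ?_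
    · rw [Fin.last_add_one]
      exact hlast
    · rw [Fin.coeSucc_eq_succ]
      exact h.isTriad (2 * i + 1) (by omega) (by simp)

end IsAltFan

/-! ### Ends of maximal alternating fans -/

/-- No alternating fan of `M` or of its dual properly contains the set `F`. This is the maximality
of the elements of a fan, stated for alternating fans, which begin with a triangle of `M` or
of `M✶`. -/
def IsAltMaximal (M : Matroid α) (F : Set α) : Prop :=
  ∀ (m : ℕ) (y : ℕ → α), IsAltFan M m y ∨ IsAltFan M✶ m y → ¬ F ⊂ y '' Iio m

lemma IsAltMaximal.dual {F : Set α} (h : IsAltMaximal M F) : IsAltMaximal M✶ F := by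
  intro m y hy
  rw [dual_dual] at hy
  exact h m y hy.symm

namespace IsAltFan

variable {x : ℕ → α}

lemma mem_of_isTriad (h : IsAltFan M k x) (hmax : IsAltMaximal M (x '' Iio k)) {y : α}
    (hT : M.IsTriad {y, x 0, x 1}) : y ∈ x '' Iio k := by
  by_contra hy
  refine hmax _ _ (.inr (h.cons hy hT)) ?_
  rw [image_cons]
  exact ssubset_insert hy

lemma swap_middle (h : IsAltFan M 4 x) : IsAltFan M 4 (x ∘ Equiv.swap 1 2) where
  injOn := h.injOn.comp (Equiv.swap 1 2).injective.injOn
    (by decide : ∀ n < 4, Equiv.swap 1 2 n < 4)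
  isTriangle i hi hp := by
    obtain rfl : i = 0 := by grind
    exact IsTriangle.swap_right (h.isTriangle 0 hi hp)
  isTriad i hi hp := by
    obtain rfl : i = 1 := by grind
    exact IsTriad.swap (h.isTriad 1 hi hp)

lemma image_swap_middle (x : ℕ → α) : (x ∘ Equiv.swap 1 2) '' Iio 4 = x '' Iio 4 := by
  have hlt : ∀ n < 4, Equiv.swap 1 2 n < 4 := by decide
  ext z
  constructor
  · rintro ⟨i, hi, rfl⟩
    exact ⟨_, hlt i hi, rfl⟩
  · rintro ⟨i, hi, rfl⟩
    exact ⟨_, hlt i hi, by simp⟩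

lemma four_le_of_notMem {j : ℕ} (hj : x j ∉ ({x 0, x 1, x 2, x 3} : Set α)) : 4 ≤ j := by
  by_contra! h
  interval_cases j <;> simp at hj

lemma eq_fifth_of_isTriad (h : IsAltFan M 5 x) {y : α} (hy : y ≠ x 3)
    (hK : M.IsTriad {x 0, x 2, y}) : y = x 4 := by
  obtain (h3 | h3 | h3) | (h4 | h4 | h4) :=
    IsTriangle.mem_or_mem (h.isTriangle 2 (by omega) (by decide)) hK.1 (by simp)
  · exact (h.ne (by omega) (by omega) (by omega) h3).elim
  · exact (h.ne (by omega) (by omega) (by omega) h3).elim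
  · exact (hy h3.symm).elim
  · exact (h.ne (by omega) (by omega) (by omega) h4).elim
  · exact (h.ne (by omega) (by omega) (by omega) h4).elim
  · exact h4.symm

section Finite

variable [M.Finite]

lemma rk_dual_image_five_le (h : IsAltFan M 5 x) (hK : M.IsTriad {x 0, x 2, x 4}) :
    rk M✶ (x '' Iio 5) ≤ 3 := by
  have hT := h.isTriangle 0 (by omega) (by simp)
  have hsub : {x 0, x 1, x 2} ⊆ M✶.E := h.triple_subset_ground (i := 0) (by omega)
  have hcl : x '' Iio 5 ⊆ M✶.closure {x 0, x 1, x 2} := by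
    rintro _ ⟨i, hi, rfl⟩
    rw [mem_Iio] at hi
    interval_cases i
    · exact M✶.mem_closure_of_mem (by simp) hsub
    · exact M✶.mem_closure_of_mem (by simp) hsub
    · exact M✶.mem_closure_of_mem (by simp) hsub
    · exact M✶.closure_subset_closure (pair_subset (by simp) (by simp)) (IsTriangle.mem_closure
        (IsTriangle.swap (IsTriangle.swap_right (h.isTriad 1 (by omega) (by simp)))))
    · exact M✶.closure_subset_closure (pair_subset (by simp) (by simp))
        (IsTriangle.mem_closure (IsTriangle.swap (IsTriangle.swap_right hK)))
  exact (rk_le_of_subset_closure hcl).trans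
    ((rk_le_ncard (toFinite _)).trans (IsTriangle.ncard_eq hT).le)

lemma exists_ground_eq_insert_image_five (hM : M.IsKConnected 3) (h : IsAltFan M 5 x)
    (hK : M.IsTriad {x 0, x 2, x 4}) :
    ∃ z ∉ x '' Iio 5, M.E = insert z (x '' Iio 5) ∧ rk M M.E = 3 := by
  have hAE := h.image_subset_ground (by omega)
  have hA := h.ncard_image
  have hcard := ncard_sdiff_add_ncard_of_subset hAE M.ground_finite
  have hsix := IsKConnected.six_le_ncard hM (by omega) (h.isTriangle 0 (by omega) (by simp))
    (h.isTriad 1 (by omega) (by simp))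
  have hrk : rk M (x '' Iio 5) ≤ 3 := h.rk_image_odd_le (m := 2) (by omega)
  have hrkdual := h.rk_dual_image_five_le hK
  have hsmall : (M.E \ x '' Iio 5).ncard < 2 :=
    IsKConnected.ncard_sdiff_lt hM (by omega) hAE (by omega) (by omega)
  obtain ⟨z, hz⟩ := ncard_eq_one.1 (by omega : (M.E \ x '' Iio 5).ncard = 1)
  have hzA : z ∈ M.E \ x '' Iio 5 := hz.symm ▸ rfl
  have hspan := IsKConnected.rk_sdiff_eq hM (by omega) (X := M.E \ x '' Iio 5) sdiff_subset
    (by omega)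
  have hspandual := IsKConnected.rk_sdiff_eq (IsKConnected.dual hM) (by rw [dual_ground]; omega)
    (X := M.E \ x '' Iio 5) sdiff_subset (by omega)
  rw [dual_ground, sdiff_sdiff_cancel_left hAE] at hspandual
  rw [sdiff_sdiff_cancel_left hAE] at hspan
  have hsum := rk_ground_add_rk_dual_ground (M := M)
  refine ⟨z, hzA.2, ?_, by omega⟩
  rw [insert_eq, ← hz, sdiff_union_of_subset hAE]

lemma exists_isTriad_of_first_third_fifth (hM : M.IsKConnected 3) (h : IsAltFan M 5 x)
    (hK : M.IsTriad {x 0, x 2, x 4}) : ∃ z ∉ x '' Iio 5, M.IsTriad {z, x 0, x 1} := by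
  obtain ⟨z, hz, hE, hrk⟩ := h.exists_ground_eq_insert_image_five hM hK
  have hzne (i : ℕ) (hi : i < 5) : z ≠ x i := fun hzi ↦ hz ⟨i, hi, hzi.symm⟩
  have hE5 := h.le_ncard_ground (by omega)
  have hcompl : M.E \ {z, x 0, x 1} ⊆ {x 2, x 3, x 4} := by
    rw [hE]
    rintro _ ⟨rfl | ⟨i, hi, rfl⟩, hne⟩
    · simp at hne
    · rw [mem_Iio] at hi
      interval_cases i <;> simp_all
  refine ⟨z, hz, IsKConnected.isTriad_of_rk_lt hM (by omega) ?_ ?_ ?_⟩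
  · rw [hE]
    exact insert_subset_insert (pair_subset ⟨0, by simp, rfl⟩ ⟨1, by simp, rfl⟩)
  · exact ncard_eq_three.2 ⟨z, x 0, x 1, hzne 0 (by omega), hzne 1 (by omega),
      h.ne (by omega) (by omega) (by omega), rfl⟩
  · have := rk_mono (M := M) hcompl
    rw [IsTriangle.rk_eq (h.isTriangle 2 (by omega) (by decide))] at this
    omega

lemma exists_isTriad_of_not_delete_first (hM : M.IsKConnected 3) (h : IsAltFan M k x)
    (hk : 4 ≤ k) (hmax : IsAltMaximal M (x '' Iio k)) (hdel : ¬ (M ＼ {x 0}).IsKConnected 3) :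
    ∃ z ∉ ({x 0, x 1, x 2, x 3} : Set α), M.IsTriad {z, x 0, x 1} := by
  obtain ⟨y, hy, hK | hK⟩ := IsKConnected.exists_isTriad_of_not_delete hM
    (hk.trans (h.le_ncard_ground (by omega))) (h.isTriangle 0 (by omega) (by simp))
    (h.isTriad 1 (by omega) (by simp)) (h.ne (by omega) (by omega) (by omega)) hdel
  · exact ⟨y, hy, IsTriad.swap (IsTriad.swap_right hK)⟩
  obtain rfl | hk5 := hk.eq_or_lt
  · obtain ⟨j, hj, rfl⟩ := image_swap_middle x ▸ h.swap_middle.mem_of_isTriad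
      (by rwa [image_swap_middle]) (IsTriad.swap (IsTriad.swap_right hK))
    exact (four_le_of_notMem hy).not_gt hj |>.elim
  · have h5 := h.mono hk5
    obtain rfl := h5.eq_fifth_of_isTriad (by rintro rfl; simp at hy) hK
    obtain ⟨z, hz, hzK⟩ := h5.exists_isTriad_of_first_third_fifth hM hK
    refine ⟨z, fun hmem ↦ hz ?_, hzK⟩
    obtain rfl | rfl | rfl | rfl := hmem <;> exact mem_image_of_mem x (by simp)

end Finite

lemma exists_length_eq_of_isTriad (h : IsAltFan M k x) {j : ℕ} (hj : j < k) (hj4 : 4 ≤ j)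
    (hK : M.IsTriad {x j, x 0, x 1}) : ∃ m, j = 2 * m + 1 ∧ k = 2 * m + 2 := by
  have hnot {i : ℕ} (hi : i < k) (hij : i ≠ j) (hi2 : 2 ≤ i) :
      x i ∉ ({x j, x 0, x 1} : Set α) := by
    rintro (h' | h' | h') <;> exact h.ne hi (by omega) (by omega) h'
  obtain ⟨m, rfl | rfl⟩ := Nat.even_or_odd' j
  · obtain ⟨n, rfl⟩ : ∃ n, m = n + 1 := ⟨m - 1, by omega⟩
    have hT := h.isTriangle (2 * n) (by omega) (by simp)
    exact (IsTriangle.mem_or_mem (IsTriangle.swap (IsTriangle.swap_right hT)) hK.1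
      (by simp [mul_add])).elim (hnot (by omega) (by omega) (by omega))
      (hnot (by omega) (by omega) (by omega)) |>.elim
  · refine ⟨m, rfl, ?_⟩
    by_contra hne
    have hT := h.isTriangle (2 * m) (by omega) (by simp)
    exact (IsTriangle.mem_or_mem (IsTriangle.swap hT) hK.1 (by simp)).elim
      (hnot (by omega) (by omega) (by omega)) (hnot (by omega) (by omega) (by omega))

lemma isKConnected_delete_first [M.Finite] (hM : M.IsKConnected 3) (h : IsAltFan M k x)
    (hk : 4 ≤ k) (hmax : IsAltMaximal M (x '' Iio k)) (hcyc : ¬ ∃ r φ, IsCyclicFan M r φ) :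
    (M ＼ {x 0}).IsKConnected 3 := by
  by_contra hdel
  obtain ⟨z, hz, hK⟩ := h.exists_isTriad_of_not_delete_first hM hk hmax hdel
  obtain ⟨j, hj, rfl⟩ := h.mem_of_isTriad hmax hK
  obtain ⟨m, rfl, rfl⟩ := h.exists_length_eq_of_isTriad hj (four_le_of_notMem hz) hK
  exact hcyc ⟨_, _, h.isCyclicFan hM (by omega) hK⟩

lemma isMinor_delete_first (h : IsAltFan M k x) (hk : 4 ≤ k) (hN : N ≤m M)
    (hloop : ∀ e, ¬ N.IsLoop e) (hcoloop : ∀ e, ¬ N.IsColoop e) (hfirst : ∀ i < 3, x i ∉ N.E) :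
    N ≤m M ＼ {x 0} :=
  isMinor_delete_of_isTriangle_of_isTriad (h.isTriangle 0 (by omega) (by simp))
    (h.isTriad 1 (by omega) (by simp)) (h.ne (by omega) (by omega) (by omega)) hN hloop hcoloop
    (hfirst 0 (by omega)) (hfirst 1 (by omega)) (hfirst 2 (by omega))

lemma isMinor_delete_first_or_contract_fourth (h : IsAltFan M k x) (hk : 4 ≤ k) (hN : N ≤m M)
    (hloop : ∀ e, ¬ N.IsLoop e) (hcoloop : ∀ e, ¬ N.IsColoop e) (h0 : x 0 ∉ N.E)
    (h12 : x 1 ∉ N.E ∨ x 2 ∉ N.E) (h3 : x 3 ∉ N.E) : N ≤m M ＼ {x 0} ∨ N ≤m M ／ {x 3} := by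
  have hT := h.isTriangle 0 (by omega) (by simp)
  have hK := h.isTriad 1 (by omega) (by simp)
  have hne : x 0 ≠ x 3 := h.ne (by omega) (by omega) (by omega)
  obtain h1 | h2 := h12
  · exact isMinor_delete_or_contract_of_isTriangle_of_isTriad hT hK hne hN hloop hcoloop h0 h1 h3
  · exact isMinor_delete_or_contract_of_isTriangle_of_isTriad (IsTriangle.swap_right hT)
      (IsTriad.swap hK) hne hN hloop hcoloop h0 h2 h3

lemma index_eq (h : IsAltFan M k x) (hsub : (N.E ∩ x '' Iio k).Subsingleton) {i j : ℕ}
    (hi : i < k) (hj : j < k) (hiN : x i ∈ N.E) (hjN : x j ∈ N.E) : i = j :=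
  h.injOn hi hj (hsub ⟨hiN, i, hi, rfl⟩ ⟨hjN, j, hj, rfl⟩)

lemma isMinor_delete_first_or_contract_last (h : IsAltFan M k x) (hk : 4 ≤ k) (hp : Even k)
    (hN : N ≤m M) (hloop : ∀ e, ¬ N.IsLoop e) (hcoloop : ∀ e, ¬ N.IsColoop e)
    (hsub : (N.E ∩ x '' Iio k).Subsingleton) : N ≤m M ＼ {x 0} ∨ N ≤m M ／ {x (k - 1)} := by
  by_cases! hfirst : ∀ i < 3, x i ∉ N.E
  · exact .inl (h.isMinor_delete_first hk hN hloop hcoloop hfirst)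
  obtain ⟨j, hj, hjN⟩ := hfirst
  have hnot (i : ℕ) (hi : i < k) (hij : i ≠ j) : x i ∉ N.E := fun hiN ↦
    hij (h.index_eq hsub hi (by omega) hiN hjN)
  by_cases hmiddle : k = 4 ∧ j ≠ 0
  · obtain ⟨rfl, hj0⟩ := hmiddle
    refine h.isMinor_delete_first_or_contract_fourth hk hN hloop hcoloop
      (hnot 0 (by omega) hj0.symm) ?_ (hnot 3 (by omega) (by omega))
    obtain hj1 | hj2 : 1 ≠ j ∨ 2 ≠ j := by omega
    exacts [.inl (hnot 1 (by omega) hj1), .inr (hnot 2 (by omega) hj2)]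
  · right
    rw [← isMinor_dual_iff, dual_contract]
    exact (h.reverse_of_even hp).isMinor_delete_first hk (isMinor_dual_iff.2 hN)
      (by simpa using hcoloop) (by simpa using hloop) fun i hi ↦ hnot _ (by omega) (by grind)

lemma isMinor_delete_first_or_delete_last (h : IsAltFan M k x) (hk : 4 ≤ k) (hp : Odd k)
    (hN : N ≤m M) (hloop : ∀ e, ¬ N.IsLoop e) (hcoloop : ∀ e, ¬ N.IsColoop e)
    (hsub : (N.E ∩ x '' Iio k).Subsingleton) : N ≤m M ＼ {x 0} ∨ N ≤m M ＼ {x (k - 1)} := by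
  by_cases! hfirst : ∀ i < 3, x i ∉ N.E
  · exact .inl (h.isMinor_delete_first hk hN hloop hcoloop hfirst)
  obtain ⟨j, hj, hjN⟩ := hfirst
  have hnot (i : ℕ) (hi : i < k) (hij : i ≠ j) : x i ∉ N.E := fun hiN ↦
    hij (h.index_eq hsub hi (by omega) hiN hjN)
  by_cases hmiddle : k = 5 ∧ j = 2
  · obtain ⟨rfl, rfl⟩ := hmiddle
    refine (h.isMinor_delete_first_or_contract_fourth hk hN hloop hcoloop (hnot 0 (by omega)
      (by omega)) (.inl (hnot 1 (by omega) (by omega))) (hnot 3 (by omega) (by omega))).imp_right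
      fun hcontract ↦ ?_
    have hT := IsTriangle.swap_right (IsTriangle.swap (h.isTriangle 2 (by omega) (by decide)))
    have hminor := IsTriangle.isMinor_contract_delete hT hcontract
      (hnot 4 (by omega) (by omega)) hloop
    rw [contract_delete_comm _ (disjoint_singleton.2 (IsTriangle.ne hT).1)] at hminor
    exact hminor.trans (contract_isMinor _ _)
  · right
    exact (h.reverse_of_odd hp).isMinor_delete_first hk hN hloop hcoloop
      fun i hi ↦ hnot _ (by omega) (by grind)

lemma exists_end_isKConnected_isMinor [M.Finite] (hM : M.IsKConnected 3) (h : IsAltFan M k x)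
    (hk : 4 ≤ k) (hmax : IsAltMaximal M (x '' Iio k)) (hcyc : ¬ ∃ r φ, IsCyclicFan M r φ)
    (hN : N ≤m M) (hloop : ∀ e, ¬ N.IsLoop e) (hcoloop : ∀ e, ¬ N.IsColoop e)
    (hsub : (N.E ∩ x '' Iio k).Subsingleton) :
    ((M ＼ {x 0}).IsKConnected 3 ∧ N ≤m M ＼ {x 0}) ∨
      ((M ＼ {x (k - 1)}).IsKConnected 3 ∧ N ≤m M ＼ {x (k - 1)}) ∨
      ((M ／ {x (k - 1)}).IsKConnected 3 ∧ N ≤m M ／ {x (k - 1)}) := by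
  have hfirst := h.isKConnected_delete_first hM hk hmax hcyc
  obtain hp | hp := Nat.even_or_odd k
  · refine (h.isMinor_delete_first_or_contract_last hk hp hN hloop hcoloop hsub).imp
      (⟨hfirst, ·⟩) fun hminor ↦ .inr ⟨?_, hminor⟩
    rw [← isKConnected_dual_iff, dual_contract]
    refine (h.reverse_of_even hp).isKConnected_delete_first (IsKConnected.dual hM) hk
      (by rw [image_reverse]; exact hmax.dual) (by rwa [exists_isCyclicFan_dual_iff])
  · refine (h.isMinor_delete_first_or_delete_last hk hp hN hloop hcoloop hsub).imp
      (⟨hfirst, ·⟩) fun hminor ↦ .inl ⟨?_, hminor⟩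
    exact (h.reverse_of_odd hp).isKConnected_delete_first hM hk (by rwa [image_reverse]) hcyc

end IsAltFan

/-! ### Fans -/

section Fan

variable {x : Fin k → α} {y : ℕ → α}

lemma IsFan.of_dual (h : M✶.IsFan x) : M.IsFan x where
  three_le := h.three_le
  injective := h.injective
  mem_ground := h.mem_ground
  first := h.first.symm.imp_left dual_isTriad.1
  triad_of_triangle i hi hT := h.triangle_of_triad i hi (dual_isTriad.2 hT)
  triangle_of_triad i hi hT := dual_isTriad.1 (h.triad_of_triangle i hi hT)

lemma isFan_dual_iff : M✶.IsFan x ↔ M.IsFan x :=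
  ⟨IsFan.of_dual, fun h ↦ IsFan.of_dual (by rwa [dual_dual])⟩

lemma isMaximalFan_dual_iff : M✶.IsMaximalFan x ↔ M.IsMaximalFan x := by
  simp only [IsMaximalFan, isFan_dual_iff]

lemma IsAltFan.isFan [M.Finite] (hM : M.IsKConnected 3) (h : IsAltFan M k y) (hk : 5 ≤ k) :
    M.IsFan (fun i : Fin k ↦ y i) where
  three_le := by omega
  injective i j hij := Fin.ext (h.injOn i.2 j.2 hij)
  mem_ground i := h.mem_ground (by omega) i.2
  first := .inl (h.isTriangle 0 (by omega) (by simp))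
  triad_of_triangle i hi hT := by
    refine h.isTriad (i + 1) hi (Nat.even_or_odd i |>.resolve_right fun hp ↦ ?_).add_one
    exact IsKConnected.not_isTriangle_and_isTriad hM (hk.trans (h.le_ncard_ground (by omega)))
      ⟨hT, h.isTriad i (by omega) hp⟩
  triangle_of_triad i hi hT := by
    refine h.isTriangle (i + 1) hi (Nat.even_or_odd i |>.resolve_left fun hp ↦ ?_).add_one
    exact IsKConnected.not_isTriangle_and_isTriad hM (hk.trans (h.le_ncard_ground (by omega)))
      ⟨h.isTriangle i (by omega) hp, hT⟩

lemma IsFan.isAltFan (h : M.IsFan x) (hy : ∀ i : Fin k, y i = x i)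
    (hT : M.IsTriangle (consecutiveTriple x 0 h.three_le)) : IsAltFan M k y := by
  have htriple (i : ℕ) (hi : i + 2 < k) :
      consecutiveTriple x i hi = {y i, y (i + 1), y (i + 2)} := by
    rw [consecutiveTriple, ← hy, ← hy, ← hy]
  have halt (i : ℕ) (hi : i + 2 < k) : (Even i → M.IsTriangle (consecutiveTriple x i hi)) ∧
      (Odd i → M.IsTriad (consecutiveTriple x i hi)) := by
    induction i with
    | zero => exact ⟨fun _ ↦ hT, by simp⟩
    | succ i ih =>
      exact ⟨fun hp ↦ h.triangle_of_triad i hi ((ih (by omega)).2 (by grind)),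
        fun hp ↦ h.triad_of_triangle i hi ((ih (by omega)).1 (by grind))⟩
  refine ⟨fun i hi j hj hij ↦ ?_, fun i hi hp ↦ htriple i hi ▸ (halt i hi).1 hp,
    fun i hi hp ↦ htriple i hi ▸ (halt i hi).2 hp⟩
  rw [hy ⟨i, hi⟩, hy ⟨j, hj⟩] at hij
  exact congrArg Fin.val (h.injective hij)

lemma image_Iio_eq_range (hy : ∀ i : Fin k, y i = x i) : y '' Iio k = range x := by
  rw [← funext hy, ← Fin.range_val, ← range_comp]
  rfl

lemma IsMaximalFan.isAltMaximal [M.Finite] (hM : M.IsKConnected 3) (hk : 4 ≤ k)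
    (hx : M.IsMaximalFan x) : IsAltMaximal M (range x) := by
  intro m y hy hlt
  have hm : 5 ≤ m := by
    have hncard := ncard_lt_ncard hlt ((finite_Iio m).image y)
    have hx' : (range x).ncard = k := by
      rw [← image_univ, ncard_image_of_injective _ hx.1.injective, ncard_univ, Nat.card_fin]
    have hy' : (y '' Iio m).ncard = m := hy.elim IsAltFan.ncard_image IsAltFan.ncard_image
    omega
  have hfan : M.IsFan (fun i : Fin m ↦ y i) :=
    hy.elim (fun h ↦ h.isFan hM hm) fun h ↦ IsFan.of_dual (h.isFan (IsKConnected.dual hM) hm)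
  rw [image_Iio_eq_range fun _ ↦ rfl] at hlt
  exact hlt.ne (hx.2 m _ hfan hlt.subset).symm

lemma IsMaximalFan.exists_end_isKConnected_isMinor [M.Finite] (hM : M.IsKConnected 3)
    (hcyc : ¬ ∃ r φ, IsCyclicFan M r φ) (hN : N ≤m M) (hloop : ∀ e, ¬ N.IsLoop e)
    (hcoloop : ∀ e, ¬ N.IsColoop e) (hk : 4 ≤ k) (hx : M.IsMaximalFan x)
    (hT : M.IsTriangle (consecutiveTriple x 0 hx.1.three_le))
    (hsub : (N.E ∩ range x).Subsingleton) {i j : Fin k} (hi : i.val = 0) (hj : j.val = k - 1) :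
    ((M ＼ {x i}).IsKConnected 3 ∧ N ≤m M ＼ {x i}) ∨
      ((M ＼ {x j}).IsKConnected 3 ∧ N ≤m M ＼ {x j}) ∨
      ((M ／ {x j}).IsKConnected 3 ∧ N ≤m M ／ {x j}) := by
  obtain ⟨y, hy⟩ : ∃ y : ℕ → α, ∀ n : Fin k, y n = x n :=
    ⟨fun n ↦ if h : n < k then x ⟨n, h⟩ else x i, fun n ↦ by simp⟩
  have hmax := IsMaximalFan.isAltMaximal hM hk hx
  rw [← image_Iio_eq_range hy] at hmax hsub
  rw [← hy, ← hy, hi, hj]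
  exact (IsFan.isAltFan hx.1 hy hT).exists_end_isKConnected_isMinor hM hk hmax hcyc hN hloop
    hcoloop hsub

end Fan

end MatroidFan

open Matroid MatroidFan in
theorem mainTheorem5 {α : Type*} (M N : Matroid α) (hfin : M.Finite)
    (hM : M.IsKConnected 3) (hwheel : ¬ M.IsWheel) (hwhirl : ¬ M.IsWhirl)
    (hNM : N.IsMinor M) (hloop : ∀ e, ¬ N.IsLoop e) (hcoloop : ∀ e, ¬ N.IsColoop e)
    (k : ℕ) (hk : 4 ≤ k) (x : Fin k → α) (hx : M.IsMaximalFan x)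
    (hNx : (N.E ∩ Set.range x).encard ≤ 1) :
    ((M.delete {x ⟨0, by omega⟩}).IsKConnected 3 ∧
        N.IsMinor (M.delete {x ⟨0, by omega⟩})) ∨
      ((M.contract {x ⟨0, by omega⟩}).IsKConnected 3 ∧
        N.IsMinor (M.contract {x ⟨0, by omega⟩})) ∨
      ((M.delete {x ⟨k - 1, by omega⟩}).IsKConnected 3 ∧
        N.IsMinor (M.delete {x ⟨k - 1, by omega⟩})) ∨
      ((M.contract {x ⟨k - 1, by omega⟩}).IsKConnected 3 ∧
        N.IsMinor (M.contract {x ⟨k - 1, by omega⟩})) := by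
  have hcyc : ¬ ∃ r φ, IsCyclicFan M r φ := fun ⟨_, _, hφ⟩ ↦
    hφ.isWheel_or_isWhirl.elim hwheel hwhirl
  have hsub := Set.encard_le_one_iff_subsingleton.1 hNx
  obtain hT | hT := hx.1.first
  · have := IsMaximalFan.exists_end_isKConnected_isMinor hM hcyc hNM hloop hcoloop hk hx hT hsub
      (i := ⟨0, by omega⟩) (j := ⟨k - 1, by omega⟩) rfl rfl
    tauto
  · have := IsMaximalFan.exists_end_isKConnected_isMinor (IsKConnected.dual hM)
      (by rwa [exists_isCyclicFan_dual_iff]) (isMinor_dual_iff.2 hNM) (by simpa using hcoloop)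
      (by simpa using hloop) hk (isMaximalFan_dual_iff.2 hx) hT hsub
      (i := ⟨0, by omega⟩) (j := ⟨k - 1, by omega⟩) rfl rfl
    simp only [← dual_contract, ← dual_delete, isKConnected_dual_iff, isMinor_dual_iff] at this
    tauto
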